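/- Let $u\colon R\to U$ be a homological epimorphism of associative unital rings, i.e. a ring homomorphism such that the multiplication map $U\otimes_R U\to U$ is an isomorphism and $\operatorname{Tor}^R_i(U,U)=0$ for all $i>0$. For $\star\in\{\mathrm b,+,-,\varnothing\}$ let $\mathsf D^\star(R\text{-mod})$ and $\mathsf D^\star(U\text{-mod})$ be the corresponding (bounded, bounded below, bounded above, unbounded) derived categories of left modules, and let $u_*\colon\mathsf D^\star(U\text{-mod})\to\mathsf D^\star(R\text{-mod})$ be the restriction of scalars; this functor is fully faithful. A left $R$-module $M$ is a *$u$-comodule* if $U\otimes_R M=0=\operatorname{Tor}^R_1(U,M)$; a left $R$-module $C$ is a *$u$-contramodule* if $\operatorname{Hom}_R(U,C)=0=\operatorname{Ext}^1_R(U,C)$. Let $\mathsf D^\star_{u\text{-co}}(R\text{-mod})$ and $\mathsf D^\star_{u\text{-ctra}}(R\text{-mod})$ be the full subcategories of $\mathsf D^\star(R\text{-mod})$ consisting of the complexes all of whose cohomology modules are $u$-comodules, respectively $u$-contramodules. (a) Assume that the right $R$-module $U$ has flat dimension at most $1$. Then the functor $u^*=U\otimes_R-$ has a left derived functor $\mathbb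 L u^*\colon\mathsf D(R\text{-mod})\to\mathsf D(U\text{-mod})$, which is left adjoint to $u_*$, and for every symbol $\star$ it restricts to a functor $\mathsf D^\star(R\text{-mod})\to\mathsf D^\star(U\text{-mod})$ whose kernel is $\mathsf D^\star_{u\text{-co}}(R\text{-mod})$. Hence $\mathsf D^\star_{u\text{-co}}(R\text{-mod})$ is a triangulated subcategory, and the composition of its inclusion into $\mathsf D^\star(R\text{-mod})$ with the Verdier quotient functor is a triangulated equivalence $$\mathsf D^\star_{u\text{-co}}(R\text{-mod})\;\cong\;\mathsf D^\star(R\text{-mod})/u_*\mathsf D^\star(U\text{-mod}).$$ (b) Assume that the left $R$-module $U$ has projective dimension at most $1$. Then the functor $u^!=\operatorname{Hom}_R(U,-)$ has a right derived functor $\mathbb R u^!\colon\mathsf D(R\text{-mod})\to\mathsf D(U\text{-mod})$, which is right adjoint to $u_*$, and for every symbol $\star$ it restricts to a functor $\mathsf D^\star(R\text{-mod})\to\mathsf D^\star(U\text{-mod})$ whose kernel is $\mathsf D^\star_{u\text{-ctra}}(R\text{-mod})$. Hence $\mathsf D^\star_{u\text{-ctra}}(R\text{-mod})$ is a triangulated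 subcategory, and the composition of its inclusion into $\mathsf D^\star(R\text{-mod})$ with the Verdier quotient functor is a triangulated equivalence $$\mathsf D^\star_{u\text{-ctra}}(R\text{-mod})\;\cong\;\mathsf D^\star(R\text{-mod})/u_*\mathsf D^\star(U\text{-mod}).$$ -/

import Mathlib

open CategoryTheory Limits TensorProduct

universe w₁ w₂ u

noncomputable section

namespace RingEpi

variable {R U : Type u} [Ring R] [Ring U] (f : R →+* U)

/-! ### Extension of scalars along a homomorphism of associative rings -/

/-- The `U`-submodule of `U ⊗[ℤ] M` generated by the elements `(x · f r) ⊗ m - x ⊗ (r · m)`.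
The set of these generators is stable under left multiplications by elements of `U`, so this is
also the additive subgroup generated by them. -/
def balancingRelations (M : Type u) [AddCommGroup M] [Module R M] : Submodule U (U ⊗[ℤ] M) :=
  Submodule.span U {t | ∃ (x : U) (r : R) (m : M), t = (x * f r) ⊗ₜ[ℤ] m - x ⊗ₜ[ℤ] (r • m)}

/-- The tensor product `U ⊗_R M` over a (not necessarily commutative) ring `R`, where the right
`R`-module structure on `U` is given by `f`, with its left `U`-module structure. -/
abbrev ExtendedModule (M : Type u) [AddCommGroup M] [Module R M] : Type u :=
  (U ⊗[ℤ] M) ⧸ balancingRelations f M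

/-- The map `U ⊗_R M → U ⊗_R N` induced by an `R`-linear map `M → N`. -/
def extendedMap {M N : Type u} [AddCommGroup M] [Module R M] [AddCommGroup N] [Module R N]
    (g : M →ₗ[R] N) : ExtendedModule f M →ₗ[U] ExtendedModule f N :=
  Submodule.mapQ _ _
    (TensorProduct.AlgebraTensorModule.map (LinearMap.id : U →ₗ[U] U) (g.restrictScalars ℤ))
    (by
      rw [balancingRelations, Submodule.span_le]
      rintro _ ⟨x, r, m, rfl⟩
      refine Submodule.subset_span ⟨x, r, g m, ?_⟩
      simp)

lemma extendedMap_mk_tmul {M N : Type u} [AddCommGroup M] [Module R M] [AddCommGroup N]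
    [Module R N] (g : M →ₗ[R] N) (x : U) (m : M) :
    extendedMap f g (Submodule.Quotient.mk (x ⊗ₜ[ℤ] m)) = Submodule.Quotient.mk (x ⊗ₜ[ℤ] g m) :=
  rfl

lemma extendedModule_hom_ext {M : Type u} [AddCommGroup M] [Module R M] {N : Type u}
    [AddCommGroup N] [Module U N] {g h : ExtendedModule f M →ₗ[U] N}
    (H : ∀ (x : U) (m : M), g (Submodule.Quotient.mk (x ⊗ₜ[ℤ] m)) =
      h (Submodule.Quotient.mk (x ⊗ₜ[ℤ] m))) : g = h := by
  refine LinearMap.ext fun t ↦ ?_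
  obtain ⟨t, rfl⟩ := Submodule.Quotient.mk_surjective _ t
  induction t using TensorProduct.induction_on with
  | zero => simp
  | tmul x m => exact H x m
  | add a b ha hb => rw [Submodule.Quotient.mk_add, map_add, map_add, ha, hb]

/-- The functor `u^* : R-mod ⥤ U-mod`, `M ↦ U ⊗_R M`. -/
def extendScalars : ModuleCat.{u} R ⥤ ModuleCat.{u} U where
  obj M := ModuleCat.of U (ExtendedModule f M)
  map g := ModuleCat.ofHom (extendedMap f g.hom)
  map_id M := by
    ext1
    exact extendedModule_hom_ext f fun x m ↦ rfl
  map_comp g h := by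
    ext1
    exact extendedModule_hom_ext f fun x m ↦ rfl

instance : (extendScalars f).Additive where
  map_add {M N g h} := by
    ext1
    refine extendedModule_hom_ext f fun x m ↦ ?_
    change Submodule.Quotient.mk (x ⊗ₜ[ℤ] (g.hom m + h.hom m)) =
      (Submodule.Quotient.mk (x ⊗ₜ[ℤ] g.hom m) + Submodule.Quotient.mk (x ⊗ₜ[ℤ] h.hom m) :
        ExtendedModule f N)
    rw [TensorProduct.tmul_add, Submodule.Quotient.mk_add]

instance : (ModuleCat.coextendScalars.{u, u, u} f).Additive where
  map_add := rfl

lemma restrictScalars_map_exact (S : ShortComplex (ModuleCat.{u} U)) (h : S.Exact) :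
    (S.map (ModuleCat.restrictScalars.{u} f)).Exact := by
  rw [ShortComplex.ShortExact.moduleCat_exact_iff_function_exact] at h ⊢
  exact h

instance : PreservesFiniteLimits (ModuleCat.restrictScalars.{u} f) := by
  have := ((Functor.exact_tfae (ModuleCat.restrictScalars.{u} f)).out 1 3).mp
    (restrictScalars_map_exact f)
  exact this.1

instance : PreservesFiniteColimits (ModuleCat.restrictScalars.{u} f) := by
  have := ((Functor.exact_tfae (ModuleCat.restrictScalars.{u} f)).out 1 3).mp
    (restrictScalars_map_exact f)
  exact this.2

/-- The left `R`-module `U`. -/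
abbrev leftModule : ModuleCat.{u} R := (ModuleCat.restrictScalars f).obj (ModuleCat.of U U)

/-- The multiplication map `U ⊗_R U → U`. -/
def mulMap : ExtendedModule f (leftModule f) →ₗ[U] U :=
  Submodule.liftQ _
    (TensorProduct.AlgebraTensorModule.lift
      { toFun x :=
          { toFun y := x * (show U from y)
            map_add' := mul_add x
            map_smul' n y := mul_smul_comm n x (show U from y) }
        map_add' x x' := LinearMap.ext fun y ↦ add_mul x x' (show U from y)
        map_smul' z x := LinearMap.ext fun y ↦ mul_assoc z x (show U from y) } :
      U ⊗[ℤ] (leftModule f) →ₗ[U] U)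
    (by
      rw [balancingRelations, Submodule.span_le]
      rintro _ ⟨x, r, m, rfl⟩
      rw [SetLike.mem_coe, LinearMap.mem_ker, map_sub, sub_eq_zero]
      exact mul_assoc x (f r) (show U from m))

lemma mulMap_mk_tmul (x y : U) :
    mulMap f (Submodule.Quotient.mk (x ⊗ₜ[ℤ] (show leftModule f from y))) = x * y := rfl

/-- `Tor_i^R(U, -)`: the left derived functors of `M ↦ U ⊗_R M`, with values in left
`U`-modules. -/
abbrev tor (i : ℕ) : ModuleCat.{u} R ⥤ ModuleCat.{u} U := (extendScalars f).leftDerived i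

/-- Homological ring epimorphisms: the multiplication map `U ⊗_R U → U` is an isomorphism and
`Tor_i^R(U, U) = 0` for all `i > 0`. -/
structure IsHomologicalEpi : Prop where
  bijective_mulMap : Function.Bijective (mulMap f)
  isZero_tor (i : ℕ) (hi : 0 < i) : IsZero ((tor f i).obj (leftModule f))

/-- The right `R`-module `U` has flat dimension at most `n`:
`Tor_i^R(U, M) = 0` for all left `R`-modules `M` and all `i > n`. -/
def FlatDimLE (n : ℕ) : Prop :=
  ∀ (M : ModuleCat.{u} R) (i : ℕ), n < i → IsZero ((tor f i).obj M)

/-- The left `R`-module `U` has projective dimension at most `n`. -/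
abbrev ProjDimLE (n : ℕ) : Prop := HasProjectiveDimensionLE (leftModule f) n

/-- Left `u`-comodules: `U ⊗_R M = 0 = Tor_1^R(U, M)`. -/
def IsComodule (M : ModuleCat.{u} R) : Prop :=
  IsZero ((extendScalars f).obj M) ∧ IsZero ((tor f 1).obj M)

/-- Left `u`-contramodules: `Hom_R(U, C) = 0 = Ext^1_R(U, C)`. -/
def IsContramodule (C : ModuleCat.{u} R) : Prop :=
  Subsingleton (leftModule f ⟶ C) ∧ Subsingleton (Abelian.Ext (leftModule f) C 1)

/-! ### Derived categories -/

/-- The derived category symbols `b`, `+`, `-` and `∅`. -/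
inductive DSymbol
  | bounded
  | plus
  | minus
  | unbounded

section

variable (A : Type*) [Category* A] [Abelian A] [HasDerivedCategory.{w₁} A]

/-- The objects of `D(A)` whose cohomology is bounded, bounded below, bounded above,
or arbitrary. -/
def DSymbol.prop : DSymbol → ObjectProperty (DerivedCategory A)
  | .bounded => DerivedCategory.TStructure.t.bounded
  | .plus => DerivedCategory.TStructure.t.plus
  | .minus => DerivedCategory.TStructure.t.minus
  | .unbounded => ⊤

instance (s : DSymbol) : (s.prop A).IsTriangulated := by
  cases s <;> dsimp only [DSymbol.prop]
  · infer_instance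
  · infer_instance
  · infer_instance
  · exact { ext₂' := fun T _ _ _ ↦ ObjectProperty.le_isoClosure _ _ trivial }

/-- The derived category `D^⋆(A)`. -/
abbrev DCat (s : DSymbol) := (s.prop A).FullSubcategory

end

variable [HasDerivedCategory.{w₁} (ModuleCat.{u} R)] [HasDerivedCategory.{w₂} (ModuleCat.{u} U)]

/-- The restriction of scalars functor `u_* : D(U-mod) ⥤ D(R-mod)`. -/
abbrev restrictD : DerivedCategory (ModuleCat.{u} U) ⥤ DerivedCategory (ModuleCat.{u} R) :=
  (ModuleCat.restrictScalars f).mapDerivedCategory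

lemma plus_restrictD_obj (X : DerivedCategory (ModuleCat.{u} U))
    (hX : DerivedCategory.TStructure.t.plus X) :
    DerivedCategory.TStructure.t.plus ((restrictD f).obj X) := by
  obtain ⟨n, ⟨K, e, _⟩⟩ := hX
  exact ⟨n, ⟨_, (restrictD f).mapIso e ≪≫
    (ModuleCat.restrictScalars f).mapDerivedCategoryFactors.app K, inferInstance⟩⟩

lemma minus_restrictD_obj (X : DerivedCategory (ModuleCat.{u} U))
    (hX : DerivedCategory.TStructure.t.minus X) :
    DerivedCategory.TStructure.t.minus ((restrictD f).obj X) := by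
  obtain ⟨n, ⟨K, e, _⟩⟩ := hX
  exact ⟨n, ⟨_, (restrictD f).mapIso e ≪≫
    (ModuleCat.restrictScalars f).mapDerivedCategoryFactors.app K, inferInstance⟩⟩

lemma prop_restrictD_obj (s : DSymbol) (X : DerivedCategory (ModuleCat.{u} U))
    (hX : s.prop _ X) : s.prop _ ((restrictD f).obj X) := by
  cases s with
  | bounded => exact ⟨plus_restrictD_obj f X hX.1, minus_restrictD_obj f X hX.2⟩
  | plus => exact plus_restrictD_obj f X hX
  | minus => exact minus_restrictD_obj f X hX
  | unbounded => trivial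

/-- The restriction of scalars functor `u_* : D^⋆(U-mod) ⥤ D^⋆(R-mod)`. -/
abbrev restrictDStar (s : DSymbol) : DCat (ModuleCat.{u} U) s ⥤ DCat (ModuleCat.{u} R) s :=
  (s.prop _).lift ((s.prop _).ι ⋙ restrictD f) fun X ↦ prop_restrictD_obj f s _ X.property

/-- The functor `K(R-mod) ⥤ D(U-mod)` induced by `u^*`. -/
abbrev extendK : HomotopyCategory (ModuleCat.{u} R) (ComplexShape.up ℤ) ⥤
    DerivedCategory (ModuleCat.{u} U) :=
  (extendScalars f).mapHomotopyCategory (ComplexShape.up ℤ) ⋙ DerivedCategory.Qh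

/-- The functor `K(R-mod) ⥤ D(U-mod)` induced by `u^!`, where `u^!(M) = Hom_R(U, M)`. -/
abbrev coextendK : HomotopyCategory (ModuleCat.{u} R) (ComplexShape.up ℤ) ⥤
    DerivedCategory (ModuleCat.{u} U) :=
  (ModuleCat.coextendScalars f).mapHomotopyCategory (ComplexShape.up ℤ) ⋙ DerivedCategory.Qh

/-- The existence of the derived functor `L u^*` on the unbounded derived category. -/
abbrev HasLExtend : Prop :=
  (extendK f).HasLeftDerivedFunctor (HomotopyCategory.quasiIso (ModuleCat.{u} R) (.up ℤ))

/-- The existence of the derived functor `R u^!` on the unbounded derived category. -/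
abbrev HasRCoextend : Prop :=
  (coextendK f).HasRightDerivedFunctor (HomotopyCategory.quasiIso (ModuleCat.{u} R) (.up ℤ))

/-- The left derived functor `L u^* : D(R-mod) ⥤ D(U-mod)` of `u^*`. -/
def lExtend [HasLExtend f] :
    DerivedCategory (ModuleCat.{u} R) ⥤ DerivedCategory (ModuleCat.{u} U) :=
  (extendK f).totalLeftDerived DerivedCategory.Qh (HomotopyCategory.quasiIso _ (.up ℤ))

/-- The right derived functor `R u^! : D(R-mod) ⥤ D(U-mod)` of `u^!`. -/
def rCoextend [HasRCoextend f] :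
    DerivedCategory (ModuleCat.{u} R) ⥤ DerivedCategory (ModuleCat.{u} U) :=
  (coextendK f).totalRightDerived DerivedCategory.Qh (HomotopyCategory.quasiIso _ (.up ℤ))

/-- A functor `D(R-mod) ⥤ D(U-mod)` takes `D^⋆(R-mod)` into `D^⋆(U-mod)`. -/
def PreservesDStar (F : DerivedCategory (ModuleCat.{u} R) ⥤ DerivedCategory (ModuleCat.{u} U))
    (s : DSymbol) : Prop :=
  ∀ X, s.prop _ X → s.prop _ (F.obj X)

/-- The functor `D^⋆(R-mod) ⥤ D^⋆(U-mod)` induced by a functor `D(R-mod) ⥤ D(U-mod)`. -/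
abbrev inducedDStar (F : DerivedCategory (ModuleCat.{u} R) ⥤ DerivedCategory (ModuleCat.{u} U))
    (s : DSymbol) (h : PreservesDStar F s) :
    DCat (ModuleCat.{u} R) s ⥤ DCat (ModuleCat.{u} U) s :=
  (s.prop _).lift ((s.prop _).ι ⋙ F) fun X ↦ h _ X.property

/-- `D^⋆_{u-co}(R-mod)`: the complexes whose cohomology modules are `u`-comodules. -/
def dComodule (s : DSymbol) : ObjectProperty (DCat (ModuleCat.{u} R) s) :=
  fun X ↦ ∀ n : ℤ, IsComodule f ((DerivedCategory.homologyFunctor _ n).obj X.obj)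

/-- `D^⋆_{u-ctra}(R-mod)`: the complexes whose cohomology modules are `u`-contramodules. -/
def dContramodule (s : DSymbol) : ObjectProperty (DCat (ModuleCat.{u} R) s) :=
  fun X ↦ ∀ n : ℤ, IsContramodule f ((DerivedCategory.homologyFunctor _ n).obj X.obj)

/-- The Verdier quotient `D^⋆(R-mod) / u_* D^⋆(U-mod)`: the localization of `D^⋆(R-mod)` with
respect to the morphisms whose cone is isomorphic to an object in the image of `u_*`. -/
abbrev VerdierQuotient (s : DSymbol) : Type _ := (restrictDStar f s).essImage.trW.Localization

/-- The composition of the inclusion of a full subcategory `P ⊆ D^⋆(R-mod)` with the Verdier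
quotient functor `D^⋆(R-mod) ⥤ D^⋆(R-mod) / u_* D^⋆(U-mod)`. -/
abbrev toVerdierQuotient (s : DSymbol) (P : ObjectProperty (DCat (ModuleCat.{u} R) s)) :
    P.FullSubcategory ⥤ VerdierQuotient f s :=
  P.ι ⋙ (restrictDStar f s).essImage.trW.Q

end RingEpi

end

open RingEpi

/-!
The two halves are dual to each other. If `u_*` is fully faithful with a left adjoint `L`, then
the kernel of `L` is the left orthogonal of the image of `u_*`, and the triangle on the unit
`X ⟶ u_* L X` shows that every object is, modulo the image, isomorphic to an object of this
kernel; therefore the kernel is equivalent to the Verdier quotient (`isEquivalence_of_leftAdjoint`,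
and `isEquivalence_of_rightAdjoint` for the dual). It remains to construct the derived functors
`L u^*` and `R u^!` on the unbounded derived categories, to show that the counit, respectively
the unit, of the derived adjunction is an isomorphism, and to compute the kernels.

The modules `M` with `Tor_1^R(U, M) = 0` are closed under submodules when the flat dimension of
`U` is at most `1` (`PreservesMonosOver.of_mono`). Hence a complex has a resolution by such modules
of length one: the kernel of an epimorphism from a contractible complex with free terms, suitably
shifted, is a complex of this type quasi-isomorphic to the given one (`leftRes`). It depends
functorially on the complex, and no boundedness is needed. For a complex `X` with such terms, the
exactness of `U ⊗_R X` in degree `n` is equivalent to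
`U ⊗_R H^n(X) = 0 = Tor_1^R(U, H^{n+1}(X))` (`exactAt_extendScalars_iff`). In particular `U ⊗_R -`
preserves the acyclicity of such complexes, hence their quasi-isomorphisms, and so the left derived
functor exists and is computed by them (`hasLeftDerivedFunctor_of_resolution`,
`leftDerived_adjunction`). The same criterion shows that `L u^* X = 0` if and only if the
cohomology modules of `X` are `u`-comodules, and that `L u^*` has cohomological amplitude in
`[-1, 0]`, so that it preserves the boundedness conditions.

Dually, the modules with `Ext^1_R(U, M) = 0` are closed under quotients when the projective
dimension of `U` is at most `1` (`extVanishing.of_epi`), and every complex embeds functorially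
in a contractible complex with injective terms, the shifted cokernel being the resolution
(`rightRes`). The functorial embeddings in injective modules are obtained by the small object
argument.

That `u` is a homological epimorphism is used as follows: `U ⊗_R N ≅ N ≅ Hom_R(U, N)`,
`Tor_1^R(U, N) = 0` and `Ext^1_R(U, N) = 0` for every `U`-module `N`. Thus the derived functors are
computed on complexes of `U`-modules by the underived ones, and the counit and the unit of the
derived adjunctions are isomorphisms.
-/

noncomputable section

namespace RingEpi

/-! ### Derived functors from functorial resolutions -/

section DerivedFunctors

variable {C C' D H : Type*} [Category* C] [Category* C'] [Category* D] [Category* H]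

/-- Let `q : ρ ⟶ π` be resolutions of the objects of `C'`, which are functorial on a category `C`
above `C'`. A natural transformation `L ⋙ LF ⟶ F` which is an isomorphism at the resolutions
exhibits `LF` as a left derived functor of `F`. The category `C` (of complexes) may differ from
`C'` (the homotopy category), because functorial resolutions which do not come from additive
functors need not be compatible with homotopies. -/
lemma isLeftDerivedFunctor_of_isIso_app_resolution
    {L : C' ⥤ D} {W : MorphismProperty C'} [L.IsLocalization W]
    {F : C' ⥤ H} {LF : D ⥤ H} (α : L ⋙ LF ⟶ F)
    {π ρ : C ⥤ C'} [π.EssSurj] [((Functor.whiskeringLeft C D H).obj (π ⋙ L)).Full]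
    [((Functor.whiskeringLeft C D H).obj (π ⋙ L)).Faithful]
    (q : ρ ⟶ π) (hq : ∀ X, W (q.app X)) (hα : ∀ X, IsIso (α.app (ρ.obj X))) :
    LF.IsLeftDerivedFunctor α W := by
  have hq' : ∀ X, IsIso (L.map (q.app X)) := fun X ↦ Localization.inverts L W _ (hq X)
  -- the morphisms `γ` compatible with `β` are determined by their values at resolved objects
  have key : ∀ (G : D ⥤ H) (β : L ⋙ G ⟶ F) (γ : G ⟶ LF),
      Functor.whiskerLeft L γ ≫ α = β ↔ ∀ X, γ.app (L.obj (π.obj X)) =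
        inv (G.map (L.map (q.app X))) ≫ β.app (ρ.obj X) ≫ inv (α.app (ρ.obj X)) ≫
          LF.map (L.map (q.app X)) := by
    intro G β γ
    constructor
    · rintro rfl X
      simp
    · intro h
      ext Y
      let e := π.objObjPreimageIso Y
      set X := π.objPreimage Y
      have h₁ : γ.app (L.obj (π.obj X)) ≫ α.app (π.obj X) = β.app (π.obj X) := by
        have := α.naturality (q.app X)
        dsimp at this
        rw [h, Category.assoc, Category.assoc, Category.assoc, this, IsIso.inv_hom_id_assoc,
          IsIso.inv_comp_eq]
        exact (β.naturality (q.app X)).symm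
      have h₂ := γ.naturality (L.map e.hom)
      have h₃ := α.naturality e.hom
      have h₄ := β.naturality e.hom
      dsimp at h₂ h₃ h₄ ⊢
      rw [← cancel_epi (G.map (L.map e.hom)), reassoc_of% h₂, h₃, h₄, reassoc_of% h₁]
  -- the formula defines a morphism, since it is natural on `C` and `L` is a localization
  have ex : ∀ (G : D ⥤ H) (β : L ⋙ G ⟶ F), ∃ γ : G ⟶ LF, ∀ X, γ.app (L.obj (π.obj X)) =
        inv (G.map (L.map (q.app X))) ≫ β.app (ρ.obj X) ≫ inv (α.app (ρ.obj X)) ≫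
          LF.map (L.map (q.app X)) := by
    intro G β
    let τ : (π ⋙ L) ⋙ G ⟶ (π ⋙ L) ⋙ LF :=
      { app X := inv (G.map (L.map (q.app X))) ≫ β.app (ρ.obj X) ≫ inv (α.app (ρ.obj X)) ≫
          LF.map (L.map (q.app X))
        naturality X Y f := by
          have h₁ := β.naturality (ρ.map f)
          have h₂ := α.naturality (ρ.map f)
          dsimp at h₁ h₂ ⊢
          rw [← cancel_epi (G.map (L.map (q.app X))), ← G.map_comp_assoc, ← L.map_comp,
            ← q.naturality, L.map_comp, G.map_comp, Category.assoc, IsIso.hom_inv_id_assoc,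
            Category.assoc, Category.assoc, Category.assoc, IsIso.hom_inv_id_assoc,
            reassoc_of% h₁, ← LF.map_comp, ← L.map_comp, ← q.naturality, L.map_comp, LF.map_comp]
          congr 1
          rw [← cancel_epi (α.app (ρ.obj X)), IsIso.hom_inv_id_assoc, ← reassoc_of% h₂,
            IsIso.hom_inv_id_assoc] }
    obtain ⟨γ, hγ⟩ := ((Functor.whiskeringLeft C D H).obj (π ⋙ L)).map_surjective τ
    exact ⟨γ, fun X ↦ congr_app hγ X⟩
  refine ⟨⟨⟨IsTerminal.ofUniqueHom
    (fun E ↦ CostructuredArrow.homMk (ex E.left E.hom).choose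
      ((key _ _ _).2 (ex E.left E.hom).choose_spec)) ?_⟩⟩⟩
  intro E m
  ext : 1
  refine ((Functor.whiskeringLeft C D H).obj (π ⋙ L)).map_injective ?_
  ext X
  exact ((key _ _ _).1 (CostructuredArrow.w m) X).trans
    ((ex E.left E.hom).choose_spec X).symm

/-- Let `q : π ⟶ ρ` be resolutions of the objects of `C'`, which are functorial on a category `C`
above `C'`. A natural transformation `F ⟶ L ⋙ RF` which is an isomorphism at the resolutions
exhibits `RF` as a right derived functor of `F`. -/
lemma isRightDerivedFunctor_of_isIso_app_resolution
    {L : C' ⥤ D} {W : MorphismProperty C'} [L.IsLocalization W]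
    {F : C' ⥤ H} {RF : D ⥤ H} (α : F ⟶ L ⋙ RF)
    {π ρ : C ⥤ C'} [π.EssSurj] [((Functor.whiskeringLeft C D H).obj (π ⋙ L)).Full]
    [((Functor.whiskeringLeft C D H).obj (π ⋙ L)).Faithful]
    (q : π ⟶ ρ) (hq : ∀ X, W (q.app X)) (hα : ∀ X, IsIso (α.app (ρ.obj X))) :
    RF.IsRightDerivedFunctor α W := by
  have hq' : ∀ X, IsIso (L.map (q.app X)) := fun X ↦ Localization.inverts L W _ (hq X)
  -- the morphisms `γ` compatible with `β` are determined by their values at resolved objects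
  have key : ∀ (G : D ⥤ H) (β : F ⟶ L ⋙ G) (γ : RF ⟶ G),
      α ≫ Functor.whiskerLeft L γ = β ↔ ∀ X, γ.app (L.obj (π.obj X)) =
        RF.map (L.map (q.app X)) ≫ inv (α.app (ρ.obj X)) ≫ β.app (ρ.obj X) ≫
          inv (G.map (L.map (q.app X))) := by
    intro G β γ
    constructor
    · rintro rfl X
      simp
    · intro h
      ext Y
      let e := π.objObjPreimageIso Y
      set X := π.objPreimage Y
      have h₁ : α.app (π.obj X) ≫ γ.app (L.obj (π.obj X)) = β.app (π.obj X) := by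
        have h₂ := α.naturality (q.app X)
        have h₃ := β.naturality (q.app X)
        dsimp at h₂ h₃
        rw [h, ← reassoc_of% h₂, IsIso.hom_inv_id_assoc, reassoc_of% h₃, IsIso.hom_inv_id,
          Category.comp_id]
      have h₂ := γ.naturality (L.map e.hom)
      have h₃ := α.naturality e.hom
      have h₄ := β.naturality e.hom
      dsimp at h₂ h₃ h₄ ⊢
      rw [← cancel_epi (F.map e.hom), reassoc_of% h₃, h₂, h₄, reassoc_of% h₁]
  -- the formula defines a morphism, since it is natural on `C` and `L` is a localization
  have ex : ∀ (G : D ⥤ H) (β : F ⟶ L ⋙ G), ∃ γ : RF ⟶ G, ∀ X, γ.app (L.obj (π.obj X)) =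
        RF.map (L.map (q.app X)) ≫ inv (α.app (ρ.obj X)) ≫ β.app (ρ.obj X) ≫
          inv (G.map (L.map (q.app X))) := by
    intro G β
    let τ : (π ⋙ L) ⋙ RF ⟶ (π ⋙ L) ⋙ G :=
      { app X := RF.map (L.map (q.app X)) ≫ inv (α.app (ρ.obj X)) ≫ β.app (ρ.obj X) ≫
          inv (G.map (L.map (q.app X)))
        naturality X Y f := by
          have h₁ := β.naturality (ρ.map f)
          have h₂ := α.naturality (ρ.map f)
          dsimp at h₁ h₂ ⊢
          rw [← cancel_mono (G.map (L.map (q.app Y)))]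
          simp only [Category.assoc, IsIso.inv_hom_id, Category.comp_id]
          rw [← G.map_comp, ← L.map_comp, q.naturality, L.map_comp, G.map_comp,
            IsIso.inv_hom_id_assoc, ← h₁, ← RF.map_comp_assoc, ← L.map_comp, q.naturality,
            L.map_comp, RF.map_comp_assoc]
          congr 1
          rw [← cancel_epi (α.app (ρ.obj X)), IsIso.hom_inv_id_assoc, ← reassoc_of% h₂,
            IsIso.hom_inv_id_assoc] }
    obtain ⟨γ, hγ⟩ := ((Functor.whiskeringLeft C D H).obj (π ⋙ L)).map_surjective τ
    exact ⟨γ, fun X ↦ congr_app hγ X⟩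
  refine ⟨⟨⟨IsInitial.ofUniqueHom
    (fun E ↦ StructuredArrow.homMk (ex E.right E.hom).choose
      ((key _ _ _).2 (ex E.right E.hom).choose_spec)) ?_⟩⟩⟩
  intro E m
  ext : 1
  refine ((Functor.whiskeringLeft C D H).obj (π ⋙ L)).map_injective ?_
  ext X
  exact ((key _ _ _).1 (StructuredArrow.w m) X).trans
    ((ex E.right E.hom).choose_spec X).symm

end DerivedFunctors

section DerivedAdjunctions

variable {A B : Type*} [Category* A] [Category* B] [Abelian A] [Abelian B]
  [HasDerivedCategory.{w₁} A] [HasDerivedCategory.{w₂} B]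

/-- The adjunction between categories of complexes induced by an adjunction between additive
functors. -/
@[simps]
def mapComplexAdjunction {F : A ⥤ B} {G : B ⥤ A} [F.Additive] [G.Additive] (adj : F ⊣ G) :
    F.mapHomologicalComplex (ComplexShape.up ℤ) ⊣ G.mapHomologicalComplex (ComplexShape.up ℤ) where
  unit :=
    { app K :=
        { f n := adj.unit.app (K.X n)
          comm' i j _ := (adj.unit.naturality (K.d i j)).symm }
      naturality K L φ := by
        ext n
        exact adj.unit.naturality (φ.f n) }
  counit :=
    { app K :=
        { f n := adj.counit.app (K.X n)
          comm' i j _ := (adj.counit.naturality (K.d i j)).symm }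
      naturality K L φ := by
        ext n
        exact adj.counit.naturality (φ.f n) }
  left_triangle_components K := by
    ext n
    exact adj.left_triangle_components (K.X n)
  right_triangle_components K := by
    ext n
    exact adj.right_triangle_components (K.X n)

omit [HasDerivedCategory.{w₁} A] in
lemma isIso_of_isIso_f {K L : CochainComplex A ℤ} (φ : K ⟶ L) (h : ∀ n, IsIso (φ.f n)) :
    IsIso φ :=
  HomologicalComplex.Hom.isIso_of_components φ

instance full_whiskeringLeft_Q (H : Type*) [Category* H] :
    ((Functor.whiskeringLeft _ _ H).obj (DerivedCategory.Q (C := A))).Full :=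
  Localization.full_whiskeringLeft _ (HomologicalComplex.quasiIso A (.up ℤ)) H

instance faithful_whiskeringLeft_Q (H : Type*) [Category* H] :
    ((Functor.whiskeringLeft _ _ H).obj (DerivedCategory.Q (C := A))).Faithful :=
  Localization.faithful_whiskeringLeft _ (HomologicalComplex.quasiIso A (.up ℤ)) H

instance full_whiskeringLeft_id_Q (H : Type*) [Category* H] :
    ((Functor.whiskeringLeft _ _ H).obj (𝟭 _ ⋙ DerivedCategory.Q (C := A))).Full :=
  full_whiskeringLeft_Q H

instance faithful_whiskeringLeft_id_Q (H : Type*) [Category* H] :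
    ((Functor.whiskeringLeft _ _ H).obj (𝟭 _ ⋙ DerivedCategory.Q (C := A))).Faithful :=
  faithful_whiskeringLeft_Q H

instance isLocalization_quotient_comp_Qh :
    (HomotopyCategory.quotient A (.up ℤ) ⋙ DerivedCategory.Qh).IsLocalization
      (HomologicalComplex.quasiIso A (.up ℤ)) :=
  Functor.IsLocalization.of_iso _ (DerivedCategory.quotientCompQhIso A).symm

instance full_whiskeringLeft_quotient_comp_Qh (H : Type*) [Category* H] :
    ((Functor.whiskeringLeft _ _ H).obj
      (HomotopyCategory.quotient A (.up ℤ) ⋙ DerivedCategory.Qh)).Full :=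
  Localization.full_whiskeringLeft _ (HomologicalComplex.quasiIso A (.up ℤ)) H

instance faithful_whiskeringLeft_quotient_comp_Qh (H : Type*) [Category* H] :
    ((Functor.whiskeringLeft _ _ H).obj
      (HomotopyCategory.quotient A (.up ℤ) ⋙ DerivedCategory.Qh)).Faithful :=
  Localization.faithful_whiskeringLeft _ (HomologicalComplex.quasiIso A (.up ℤ)) H

omit [HasDerivedCategory.{w₁} A] in
lemma quotient_map_mem_quasiIso {K L : CochainComplex A ℤ} (φ : K ⟶ L) (hφ : QuasiIso φ) :
    HomotopyCategory.quasiIso A (.up ℤ) ((HomotopyCategory.quotient A (.up ℤ)).map φ) :=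
  (HomotopyCategory.quotient_map_mem_quasiIso_iff φ).2 hφ

variable (F : A ⥤ B) [F.Additive]

/-- The functor `K(A) ⥤ D(B)` induced by an additive functor `A ⥤ B` is induced by the functor
`Ch(A) ⥤ D(B)`. -/
def quotientCompMapIso :
    HomotopyCategory.quotient A (.up ℤ) ⋙ F.mapHomotopyCategory (.up ℤ) ⋙ DerivedCategory.Qh ≅
      F.mapHomologicalComplex (.up ℤ) ⋙ DerivedCategory.Q :=
  (Functor.associator _ _ _).symm ≪≫
    Functor.isoWhiskerRight (F.mapHomotopyCategoryFactors (.up ℤ)) _ ≪≫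
    Functor.associator _ _ _ ≪≫
    Functor.isoWhiskerLeft _ (DerivedCategory.quotientCompQhIso B)

section Left

variable {ρ : CochainComplex A ℤ ⥤ CochainComplex A ℤ} (q : ρ ⟶ 𝟭 _)
  (hq : ∀ X, QuasiIso (q.app X)) (good : CochainComplex A ℤ → Prop) (hρ : ∀ X, good (ρ.obj X))
  (hF : ∀ (X Y : CochainComplex A ℤ) (φ : X ⟶ Y), good X → good Y → QuasiIso φ →
    QuasiIso ((F.mapHomologicalComplex (.up ℤ)).map φ))

include hq hρ hF

/-- If there are functorial resolutions by complexes in a class `good` such that `F` preserves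
the quasi-isomorphisms between complexes in this class, then the left derived functor of `F`
exists on the unbounded derived category, and it is computed by `F` on this class. -/
lemma hasLeftDerivedFunctor_of_resolution :
    (F.mapHomotopyCategory (.up ℤ) ⋙ DerivedCategory.Qh).HasLeftDerivedFunctor
      (HomotopyCategory.quasiIso A (.up ℤ)) ∧
    ∀ (LF : DerivedCategory A ⥤ DerivedCategory B)
      (α : DerivedCategory.Qh ⋙ LF ⟶ F.mapHomotopyCategory (.up ℤ) ⋙ DerivedCategory.Qh)
      [LF.IsLeftDerivedFunctor α (HomotopyCategory.quasiIso A (.up ℤ))]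
      (X : CochainComplex A ℤ), good X →
        IsIso (α.app ((HomotopyCategory.quotient A (.up ℤ)).obj X)) := by
  let Φ := F.mapHomologicalComplex (.up ℤ) ⋙ DerivedCategory.Q
  have hΦ : ∀ {X Y : CochainComplex A ℤ} (φ : X ⟶ Y), good X → good Y → QuasiIso φ →
      IsIso (Φ.map φ) := fun φ hX hY hφ ↦ by
    have := hF _ _ φ hX hY hφ
    exact inferInstanceAs (IsIso (DerivedCategory.Q.map _))
  have hρW : (HomologicalComplex.quasiIso A (.up ℤ)).IsInvertedBy (ρ ⋙ Φ) := by
    intro X Y φ hφ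
    refine hΦ _ (hρ X) (hρ Y) ?_
    have := hq X
    have := hq Y
    have : QuasiIso φ := hφ
    have h : QuasiIso (ρ.map φ ≫ q.app Y) := by
      rw [q.naturality]
      dsimp
      infer_instance
    exact quasiIso_of_comp_right _ (q.app Y)
  let LF := Localization.lift (ρ ⋙ Φ) hρW DerivedCategory.Q
  let e : DerivedCategory.Q ⋙ LF ≅ ρ ⋙ Φ := Localization.fac _ hρW _
  obtain ⟨α, hα⟩ := ((Functor.whiskeringLeft _ _ (DerivedCategory B)).obj
    (HomotopyCategory.quotient A (.up ℤ))).map_surjective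
      (X := DerivedCategory.Qh ⋙ LF) (Y := F.mapHomotopyCategory (.up ℤ) ⋙ DerivedCategory.Qh)
      (Functor.whiskerRight (DerivedCategory.quotientCompQhIso A).hom LF ≫ e.hom ≫
        Functor.whiskerRight q Φ ≫ (quotientCompMapIso F).inv)
  have hα' : ∀ X, good X → IsIso (α.app ((HomotopyCategory.quotient A (.up ℤ)).obj X)) := by
    intro X hX
    have h := congr_app hα X
    have := hΦ (q.app X) (hρ X) hX (hq X)
    have h' : IsIso ((Functor.whiskerRight (DerivedCategory.quotientCompQhIso A).hom LF ≫ e.hom ≫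
        Functor.whiskerRight q Φ ≫ (quotientCompMapIso F).inv).app X) := by
      simp only [NatTrans.comp_app, Functor.whiskerRight_app]
      infer_instance
    rw [← h] at h'
    exact h'
  have hLF : LF.IsLeftDerivedFunctor α (HomotopyCategory.quasiIso A (.up ℤ)) :=
    isLeftDerivedFunctor_of_isIso_app_resolution (π := HomotopyCategory.quotient A (.up ℤ))
      α (Functor.whiskerRight q (HomotopyCategory.quotient A (.up ℤ)))
      (fun X ↦ quotient_map_mem_quasiIso _ (hq X)) (fun X ↦ hα' _ (hρ X))
  refine ⟨Functor.HasLeftDerivedFunctor.mk' LF α, fun LF' α' _ X hX ↦ ?_⟩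
  have := hα' X hX
  have h := Functor.leftDerivedNatTrans_app LF LF' α α' (HomotopyCategory.quasiIso A (.up ℤ))
    (𝟙 _) ((HomotopyCategory.quotient A (.up ℤ)).obj X)
  have h' : IsIso (Functor.leftDerivedNatTrans LF LF' α α'
      (HomotopyCategory.quasiIso A (.up ℤ)) (𝟙 _)) :=
    (Functor.leftDerivedUnique LF' LF α α' (HomotopyCategory.quasiIso A (.up ℤ))).isIso_hom
  rw [NatTrans.id_app, Category.comp_id] at h
  exact IsIso.of_isIso_fac_left h

variable {F}

/-- The derived adjunction of an adjunction `F ⊣ G` with `G` exact. Since the left derived functor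
of `F` is computed by resolutions, it is an absolute derived functor, in the sense that its
composition with the functor induced by `G` is again a derived functor. -/
theorem leftDerived_adjunction {G : B ⥤ A} [G.Additive] [PreservesFiniteLimits G]
    [PreservesFiniteColimits G] (adj : F ⊣ G)
    (LF : DerivedCategory A ⥤ DerivedCategory B)
    (α : DerivedCategory.Qh ⋙ LF ⟶ F.mapHomotopyCategory (.up ℤ) ⋙ DerivedCategory.Qh)
    [LF.IsLeftDerivedFunctor α (HomotopyCategory.quasiIso A (.up ℤ))] :
    (∀ X, good X → Nonempty (LF.obj (DerivedCategory.Q.obj X) ≅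
      DerivedCategory.Q.obj ((F.mapHomologicalComplex (.up ℤ)).obj X))) ∧
    ∃ adj' : LF ⊣ G.mapDerivedCategory,
      (∀ Y, IsIso (adj.counit.app Y)) →
      (∀ Y, good ((G.mapHomologicalComplex (.up ℤ)).obj Y)) → IsIso adj'.counit := by
  let α' : DerivedCategory.Q ⋙ LF ⟶ F.mapHomologicalComplex (.up ℤ) ⋙ DerivedCategory.Q :=
    Functor.whiskerRight (DerivedCategory.quotientCompQhIso A).inv LF ≫
      Functor.whiskerLeft (HomotopyCategory.quotient A (.up ℤ)) α ≫ (quotientCompMapIso F).hom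
  have hα' : ∀ X, good X → IsIso (α'.app X) := fun X hX ↦ by
    have := (hasLeftDerivedFunctor_of_resolution F q hq good hρ hF).2 LF α X hX
    simp only [α', NatTrans.comp_app, Functor.whiskerRight_app, Functor.whiskerLeft_app]
    infer_instance
  let β : G.mapHomologicalComplex (.up ℤ) ⋙ DerivedCategory.Q ⟶
      DerivedCategory.Q ⋙ G.mapDerivedCategory := G.mapDerivedCategoryFactors.inv
  have h₁ : LF.IsLeftDerivedFunctor α' (HomologicalComplex.quasiIso A (.up ℤ)) :=
    isLeftDerivedFunctor_of_isIso_app_resolution (π := 𝟭 _) α' q hq (fun X ↦ hα' _ (hρ X))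
  have h₂ : (LF ⋙ G.mapDerivedCategory).IsLeftDerivedFunctor
      ((Functor.associator _ _ _).inv ≫ Functor.whiskerRight α' G.mapDerivedCategory)
      (HomologicalComplex.quasiIso A (.up ℤ)) :=
    isLeftDerivedFunctor_of_isIso_app_resolution (π := 𝟭 _) _ q hq (fun X ↦ by
      have := hα' _ (hρ X)
      simp only [NatTrans.comp_app, Functor.whiskerRight_app]
      infer_instance)
  have h₃ : G.mapDerivedCategory.IsRightDerivedFunctor β
      (HomologicalComplex.quasiIso B (.up ℤ)) :=
    isRightDerivedFunctor_of_isIso_app_resolution (π := 𝟭 _) β (𝟙 (𝟭 _))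
      (fun X ↦ inferInstanceAs (QuasiIso (𝟙 X))) (fun X ↦ inferInstance)
  have h₄ : (G.mapDerivedCategory ⋙ LF).IsRightDerivedFunctor
      (Functor.whiskerRight β LF ≫ (Functor.associator _ _ _).hom)
      (HomologicalComplex.quasiIso B (.up ℤ)) :=
    isRightDerivedFunctor_of_isIso_app_resolution (π := 𝟭 _) _ (𝟙 (𝟭 _))
      (fun X ↦ inferInstanceAs (QuasiIso (𝟙 X))) (fun X ↦ by
        simp only [NatTrans.comp_app, Functor.whiskerRight_app]
        infer_instance)
  refine ⟨fun X hX ↦ ⟨@asIso _ _ _ _ _ (hα' X hX)⟩,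
    (mapComplexAdjunction adj).derived (HomologicalComplex.quasiIso A (.up ℤ))
      (HomologicalComplex.quasiIso B (.up ℤ)) α' β, fun hadj hG ↦ ?_⟩
  rw [NatTrans.isIso_iff_isIso_app]
  intro Y
  obtain ⟨Y, ⟨e⟩⟩ := Functor.EssSurj.mem_essImage DerivedCategory.Q Y
  rw [← NatTrans.isIso_app_iff_of_iso _ e]
  have h := (mapComplexAdjunction adj).derivedε_fac_app
    (HomologicalComplex.quasiIso B (.up ℤ)) α' β Y
  have := hα' _ (hG Y)
  have : IsIso ((mapComplexAdjunction adj).counit.app Y) :=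
    isIso_of_isIso_f _ fun n ↦ hadj (Y.X n)
  exact IsIso.of_isIso_fac_left h

end Left

section Right

variable {ρ : CochainComplex A ℤ ⥤ CochainComplex A ℤ} (q : 𝟭 _ ⟶ ρ)
  (hq : ∀ X, QuasiIso (q.app X)) (good : CochainComplex A ℤ → Prop) (hρ : ∀ X, good (ρ.obj X))
  (hF : ∀ (X Y : CochainComplex A ℤ) (φ : X ⟶ Y), good X → good Y → QuasiIso φ →
    QuasiIso ((F.mapHomologicalComplex (.up ℤ)).map φ))

include hq hρ hF

/-- If there are functorial coresolutions by complexes in a class `good` such that `F` preserves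
the quasi-isomorphisms between complexes in this class, then the right derived functor of `F`
exists on the unbounded derived category, and it is computed by `F` on this class. -/
lemma hasRightDerivedFunctor_of_resolution :
    (F.mapHomotopyCategory (.up ℤ) ⋙ DerivedCategory.Qh).HasRightDerivedFunctor
      (HomotopyCategory.quasiIso A (.up ℤ)) ∧
    ∀ (RF : DerivedCategory A ⥤ DerivedCategory B)
      (α : F.mapHomotopyCategory (.up ℤ) ⋙ DerivedCategory.Qh ⟶ DerivedCategory.Qh ⋙ RF)
      [RF.IsRightDerivedFunctor α (HomotopyCategory.quasiIso A (.up ℤ))]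
      (X : CochainComplex A ℤ), good X →
        IsIso (α.app ((HomotopyCategory.quotient A (.up ℤ)).obj X)) := by
  let Φ := F.mapHomologicalComplex (.up ℤ) ⋙ DerivedCategory.Q
  have hΦ : ∀ {X Y : CochainComplex A ℤ} (φ : X ⟶ Y), good X → good Y → QuasiIso φ →
      IsIso (Φ.map φ) := fun φ hX hY hφ ↦ by
    have := hF _ _ φ hX hY hφ
    exact inferInstanceAs (IsIso (DerivedCategory.Q.map _))
  have hρW : (HomologicalComplex.quasiIso A (.up ℤ)).IsInvertedBy (ρ ⋙ Φ) := by
    intro X Y φ hφ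
    refine hΦ _ (hρ X) (hρ Y) ?_
    have := hq X
    have := hq Y
    have : QuasiIso φ := hφ
    have h : QuasiIso (q.app X ≫ ρ.map φ) := by
      rw [← q.naturality]
      dsimp
      infer_instance
    exact quasiIso_of_comp_left (q.app X) _
  let RF := Localization.lift (ρ ⋙ Φ) hρW DerivedCategory.Q
  let e : DerivedCategory.Q ⋙ RF ≅ ρ ⋙ Φ := Localization.fac _ hρW _
  obtain ⟨α, hα⟩ := ((Functor.whiskeringLeft _ _ (DerivedCategory B)).obj
    (HomotopyCategory.quotient A (.up ℤ))).map_surjective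
      (X := F.mapHomotopyCategory (.up ℤ) ⋙ DerivedCategory.Qh) (Y := DerivedCategory.Qh ⋙ RF)
      ((quotientCompMapIso F).hom ≫ Functor.whiskerRight q Φ ≫ e.inv ≫
        Functor.whiskerRight (DerivedCategory.quotientCompQhIso A).inv RF)
  have hα' : ∀ X, good X → IsIso (α.app ((HomotopyCategory.quotient A (.up ℤ)).obj X)) := by
    intro X hX
    have h := congr_app hα X
    have := hΦ (q.app X) hX (hρ X) (hq X)
    have h' : IsIso (((quotientCompMapIso F).hom ≫ Functor.whiskerRight q Φ ≫ e.inv ≫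
        Functor.whiskerRight (DerivedCategory.quotientCompQhIso A).inv RF).app X) := by
      simp only [NatTrans.comp_app, Functor.whiskerRight_app]
      infer_instance
    rw [← h] at h'
    exact h'
  have hRF : RF.IsRightDerivedFunctor α (HomotopyCategory.quasiIso A (.up ℤ)) :=
    isRightDerivedFunctor_of_isIso_app_resolution (π := HomotopyCategory.quotient A (.up ℤ))
      α (Functor.whiskerRight q (HomotopyCategory.quotient A (.up ℤ)))
      (fun X ↦ quotient_map_mem_quasiIso _ (hq X)) (fun X ↦ hα' _ (hρ X))
  refine ⟨Functor.HasRightDerivedFunctor.mk' RF α, fun RF' α' _ X hX ↦ ?_⟩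
  have := hα' X hX
  have h := Functor.rightDerivedNatTrans_app RF RF' α α' (HomotopyCategory.quasiIso A (.up ℤ))
    (𝟙 _) ((HomotopyCategory.quotient A (.up ℤ)).obj X)
  have h' : IsIso (Functor.rightDerivedNatTrans RF RF' α α'
      (HomotopyCategory.quasiIso A (.up ℤ)) (𝟙 _)) :=
    (Functor.rightDerivedUnique RF RF' α α' (HomotopyCategory.quasiIso A (.up ℤ))).isIso_hom
  rw [NatTrans.id_app, Category.id_comp] at h
  rw [← h]
  infer_instance

variable {F}

/-- The derived adjunction of an adjunction `G ⊣ F` with `G` exact. -/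
theorem rightDerived_adjunction {G : B ⥤ A} [G.Additive] [PreservesFiniteLimits G]
    [PreservesFiniteColimits G] (adj : G ⊣ F)
    (RF : DerivedCategory A ⥤ DerivedCategory B)
    (α : F.mapHomotopyCategory (.up ℤ) ⋙ DerivedCategory.Qh ⟶ DerivedCategory.Qh ⋙ RF)
    [RF.IsRightDerivedFunctor α (HomotopyCategory.quasiIso A (.up ℤ))] :
    (∀ X, good X → Nonempty (RF.obj (DerivedCategory.Q.obj X) ≅
      DerivedCategory.Q.obj ((F.mapHomologicalComplex (.up ℤ)).obj X))) ∧
    ∃ adj' : G.mapDerivedCategory ⊣ RF,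
      (∀ Y, IsIso (adj.unit.app Y)) →
      (∀ Y, good ((G.mapHomologicalComplex (.up ℤ)).obj Y)) → IsIso adj'.unit := by
  let α' : F.mapHomologicalComplex (.up ℤ) ⋙ DerivedCategory.Q ⟶ DerivedCategory.Q ⋙ RF :=
    (quotientCompMapIso F).inv ≫ Functor.whiskerLeft (HomotopyCategory.quotient A (.up ℤ)) α ≫
      Functor.whiskerRight (DerivedCategory.quotientCompQhIso A).hom RF
  have hα' : ∀ X, good X → IsIso (α'.app X) := fun X hX ↦ by
    have := (hasRightDerivedFunctor_of_resolution F q hq good hρ hF).2 RF α X hX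
    simp only [α', NatTrans.comp_app, Functor.whiskerRight_app, Functor.whiskerLeft_app]
    infer_instance
  let β : DerivedCategory.Q ⋙ G.mapDerivedCategory ⟶
      G.mapHomologicalComplex (.up ℤ) ⋙ DerivedCategory.Q := G.mapDerivedCategoryFactors.hom
  have h₁ : RF.IsRightDerivedFunctor α' (HomologicalComplex.quasiIso A (.up ℤ)) :=
    isRightDerivedFunctor_of_isIso_app_resolution (π := 𝟭 _) α' q hq (fun X ↦ hα' _ (hρ X))
  have h₂ : (RF ⋙ G.mapDerivedCategory).IsRightDerivedFunctor
      (Functor.whiskerRight α' G.mapDerivedCategory ≫ (Functor.associator _ _ _).hom)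
      (HomologicalComplex.quasiIso A (.up ℤ)) :=
    isRightDerivedFunctor_of_isIso_app_resolution (π := 𝟭 _) _ q hq (fun X ↦ by
      have := hα' _ (hρ X)
      simp only [NatTrans.comp_app, Functor.whiskerRight_app]
      infer_instance)
  have h₃ : G.mapDerivedCategory.IsLeftDerivedFunctor β
      (HomologicalComplex.quasiIso B (.up ℤ)) :=
    isLeftDerivedFunctor_of_isIso_app_resolution (π := 𝟭 _) β (𝟙 (𝟭 _))
      (fun X ↦ inferInstanceAs (QuasiIso (𝟙 X))) (fun X ↦ inferInstance)
  have h₄ : (G.mapDerivedCategory ⋙ RF).IsLeftDerivedFunctor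
      ((Functor.associator _ _ _).inv ≫ Functor.whiskerRight β RF)
      (HomologicalComplex.quasiIso B (.up ℤ)) :=
    isLeftDerivedFunctor_of_isIso_app_resolution (π := 𝟭 _) _ (𝟙 (𝟭 _))
      (fun X ↦ inferInstanceAs (QuasiIso (𝟙 X))) (fun X ↦ by
        simp only [NatTrans.comp_app, Functor.whiskerRight_app]
        infer_instance)
  refine ⟨fun X hX ↦ ⟨(@asIso _ _ _ _ _ (hα' X hX)).symm⟩,
    (mapComplexAdjunction adj).derived (HomologicalComplex.quasiIso B (.up ℤ))
      (HomologicalComplex.quasiIso A (.up ℤ)) β α', fun hadj hG ↦ ?_⟩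
  rw [NatTrans.isIso_iff_isIso_app]
  intro Y
  obtain ⟨Y, ⟨e⟩⟩ := Functor.EssSurj.mem_essImage DerivedCategory.Q Y
  rw [← NatTrans.isIso_app_iff_of_iso _ e]
  have h := (mapComplexAdjunction adj).derivedη_fac_app
    (HomologicalComplex.quasiIso B (.up ℤ)) β α' Y
  have := hα' _ (hG Y)
  have : IsIso ((mapComplexAdjunction adj).unit.app Y) :=
    isIso_of_isIso_f _ fun n ↦ hadj (Y.X n)
  exact IsIso.of_isIso_fac_right h

end Right

end DerivedAdjunctions

/-! ### Verdier quotients by the image of a fully faithful functor with an adjoint -/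

section Verdier

open Pretriangulated

variable {T E : Type*} [Category* T] [Category* E] [Preadditive T] [HasZeroObject T]
  [HasZeroObject E] [HasZeroMorphisms E] {ι : E ⥤ T} {L : T ⥤ E}

lemma kernel_leftAdjoint_eq_leftOrthogonal (adj : L ⊣ ι) :
    L.kernel = ι.essImage.leftOrthogonal := by
  have : L.IsLeftAdjoint := adj.isLeftAdjoint
  have : ι.IsRightAdjoint := adj.isRightAdjoint
  have : L.PreservesZeroMorphisms := inferInstance
  have : ι.PreservesZeroMorphisms := inferInstance
  ext X
  constructor
  · rintro hX Y f ⟨Z, ⟨e⟩⟩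
    have h : (adj.homEquiv X Z).symm (f ≫ e.inv) = 0 := IsZero.eq_of_src hX _ _
    rw [Equiv.symm_apply_eq, adj.homEquiv_unit, Functor.map_zero, comp_zero] at h
    rw [← cancel_mono e.inv, h, zero_comp]
  · intro hX
    refine (IsZero.iff_id_eq_zero _).2 ((adj.homEquiv _ _).injective ?_)
    rw [hX (adj.homEquiv _ _ (𝟙 _)) (ι.obj_mem_essImage _)]
    exact (hX _ (ι.obj_mem_essImage _)).symm

lemma kernel_rightAdjoint_eq_rightOrthogonal (adj : ι ⊣ L) :
    L.kernel = ι.essImage.rightOrthogonal := by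
  have : L.IsRightAdjoint := adj.isRightAdjoint
  have : ι.IsLeftAdjoint := adj.isLeftAdjoint
  have : L.PreservesZeroMorphisms := inferInstance
  have : ι.PreservesZeroMorphisms := inferInstance
  ext X
  constructor
  · rintro hX Y f ⟨Z, ⟨e⟩⟩
    have h : (adj.homEquiv Z X) (e.hom ≫ f) = 0 := IsZero.eq_of_tgt hX _ _
    rw [← Equiv.eq_symm_apply, adj.homEquiv_counit, Functor.map_zero, zero_comp] at h
    rw [← cancel_epi e.hom, h, comp_zero]
  · intro hX
    refine (IsZero.iff_id_eq_zero _).2 ((adj.homEquiv _ _).symm.injective ?_)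
    rw [hX ((adj.homEquiv _ _).symm (𝟙 _)) (ι.obj_mem_essImage _)]
    exact (hX _ (ι.obj_mem_essImage _)).symm

variable [HasShift T ℤ] [∀ (n : ℤ), (shiftFunctor T n).Additive] [Pretriangulated T]
  [ι.Full] [ι.essImage.IsTriangulated]

omit [HasZeroObject E] [HasZeroMorphisms E] in
/-- The cocone of the unit of a reflection onto a triangulated subcategory is left orthogonal
to it. -/
lemma exists_trW_of_leftAdjoint (adj : L ⊣ ι) (X : T) :
    ∃ (Y : T) (s : Y ⟶ X), ι.essImage.leftOrthogonal Y ∧ ι.essImage.trW s := by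
  obtain ⟨Y, y, w, hT⟩ := distinguished_cocone_triangle₁ (adj.unit.app X)
  -- maps into the subcategory factor uniquely through the unit, also after a shift
  have bij : ∀ (Z : T), ι.essImage Z → Function.Bijective
      (fun (g : ι.obj (L.obj X) ⟶ Z) ↦ adj.unit.app X ≫ g) := by
    rintro Z ⟨V, ⟨e⟩⟩
    constructor
    · intro g₁ g₂ h
      obtain ⟨h₁, hh₁⟩ := ι.map_surjective (g₁ ≫ e.inv)
      obtain ⟨h₂, hh₂⟩ := ι.map_surjective (g₂ ≫ e.inv)
      have : h₁ = h₂ := (adj.homEquiv _ _).injective (by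
        rw [adj.homEquiv_unit, adj.homEquiv_unit, hh₁, hh₂]
        dsimp at h
        rw [reassoc_of% h])
      rw [← cancel_mono e.inv, ← hh₁, ← hh₂, this]
    · intro g
      refine ⟨ι.map ((adj.homEquiv _ _).symm (g ≫ e.inv)) ≫ e.hom, ?_⟩
      have := (adj.homEquiv _ _).apply_symm_apply (g ≫ e.inv)
      rw [adj.homEquiv_unit] at this
      dsimp
      rw [reassoc_of% this, e.inv_hom_id, Category.comp_id]
  have hyη : y ≫ adj.unit.app X = 0 := comp_distTriang_mor_zero₁₂ _ hT
  have hηw : adj.unit.app X ≫ w = 0 := comp_distTriang_mor_zero₂₃ _ hT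
  refine ⟨Y, y, fun Z g hZ ↦ ?_, _, _, _, hT, ι.obj_mem_essImage _⟩
  have h₁ : w ≫ g⟦(1 : ℤ)⟧' = 0 := (bij _ (ι.essImage.le_shift (1 : ℤ) _ hZ)).1 (by
    dsimp
    rw [reassoc_of% hηw, zero_comp, comp_zero])
  obtain ⟨h, hh⟩ : ∃ h : X⟦(1 : ℤ)⟧ ⟶ Z⟦(1 : ℤ)⟧, g⟦(1 : ℤ)⟧' = (-y⟦(1 : ℤ)⟧') ≫ h :=
    Triangle.yoneda_exact₃ _ (rot_of_distTriang _ hT) (g⟦(1 : ℤ)⟧') h₁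
  obtain ⟨h', rfl⟩ := (shiftFunctor T (1 : ℤ)).map_surjective h
  obtain ⟨k, hk⟩ := (bij _ hZ).2 h'
  dsimp at hk
  have hyh : y ≫ h' = 0 := by
    rw [← hk]
    exact (reassoc_of% hyη) _ |>.trans zero_comp
  refine (shiftFunctor T (1 : ℤ)).map_injective ?_
  rw [hh, Preadditive.neg_comp, ← Functor.map_comp, hyh, Functor.map_zero, neg_zero]

omit [HasZeroObject E] [HasZeroMorphisms E] in
/-- The cone of the counit of a coreflection onto a triangulated subcategory is right orthogonal
to it. -/
lemma exists_trW_of_rightAdjoint (adj : ι ⊣ L) (X : T) :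
    ∃ (Y : T) (s : X ⟶ Y), ι.essImage.rightOrthogonal Y ∧ ι.essImage.trW s := by
  obtain ⟨Y, y, w, hT⟩ := distinguished_cocone_triangle (adj.counit.app X)
  -- maps from the subcategory factor uniquely through the counit
  have bij : ∀ (Z : T), ι.essImage Z → Function.Bijective
      (fun (g : Z ⟶ ι.obj (L.obj X)) ↦ g ≫ adj.counit.app X) := by
    rintro Z ⟨V, ⟨e⟩⟩
    constructor
    · intro g₁ g₂ h
      obtain ⟨h₁, hh₁⟩ := ι.map_surjective (e.hom ≫ g₁)
      obtain ⟨h₂, hh₂⟩ := ι.map_surjective (e.hom ≫ g₂)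
      have : h₁ = h₂ := (adj.homEquiv _ _).symm.injective (by
        rw [adj.homEquiv_counit, adj.homEquiv_counit, hh₁, hh₂]
        dsimp at h
        rw [Category.assoc, Category.assoc, h])
      rw [← cancel_epi e.hom, ← hh₁, ← hh₂, this]
    · intro g
      refine ⟨e.inv ≫ ι.map (adj.homEquiv _ _ (e.hom ≫ g)), ?_⟩
      have := (adj.homEquiv _ _).symm_apply_apply (e.hom ≫ g)
      rw [adj.homEquiv_counit] at this
      dsimp
      rw [Category.assoc, Iso.inv_comp_eq]
      exact this
  have hεy : adj.counit.app X ≫ y = 0 := comp_distTriang_mor_zero₁₂ _ hT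
  have hwε : w ≫ (adj.counit.app X)⟦(1 : ℤ)⟧' = 0 := comp_distTriang_mor_zero₃₁ _ hT
  refine ⟨Y, y, fun Z g hZ ↦ ?_,
    (ι.essImage.trW_iff' _).2 ⟨_, _, _, hT, ι.obj_mem_essImage _⟩⟩
  have h₁ : g ≫ w = 0 := by
    let e : (Z⟦(-1 : ℤ)⟧)⟦(1 : ℤ)⟧ ≅ Z := (shiftEquiv T (1 : ℤ)).counitIso.app Z
    obtain ⟨k, hk⟩ := (shiftFunctor T (1 : ℤ)).map_surjective (e.hom ≫ g ≫ w)
    have : k = 0 := (bij _ (ι.essImage.le_shift (-1 : ℤ) _ hZ)).1 (by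
      refine (shiftFunctor T (1 : ℤ)).map_injective ?_
      dsimp
      rw [Functor.map_comp, hk, Category.assoc, Category.assoc, hwε]
      simp)
    rw [← cancel_epi e.hom, ← hk, this, Functor.map_zero, comp_zero]
  obtain ⟨h, rfl⟩ : ∃ h : Z ⟶ X, g = h ≫ y := Triangle.coyoneda_exact₃ _ hT g h₁
  obtain ⟨k, hk⟩ := (bij _ hZ).2 h
  dsimp at hk
  rw [← hk, Category.assoc]
  exact (congrArg (k ≫ ·) hεy).trans comp_zero

variable [IsTriangulated T]

/-- If the inclusion of a triangulated subcategory has a left adjoint, then the kernel of the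
left adjoint is equivalent to the Verdier quotient. -/
theorem isEquivalence_of_leftAdjoint (adj : L ⊣ ι) (P : ObjectProperty T) (hP : L.kernel = P) :
    P.IsTriangulated ∧ (P.ι ⋙ ι.essImage.trW.Q).IsEquivalence := by
  rw [kernel_leftAdjoint_eq_leftOrthogonal adj] at hP
  subst hP
  refine ⟨inferInstance, ?_⟩
  have bij : ∀ X Y : ι.essImage.leftOrthogonal.FullSubcategory, Function.Bijective
      ((ι.essImage.leftOrthogonal.ι ⋙ ι.essImage.trW.Q).map : (X ⟶ Y) → _) := fun X Y ↦
    (X.property.map_bijective_of_isTriangulated ι.essImage.trW.Q Y.obj).comp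
      (ι.essImage.leftOrthogonal.fullyFaithfulι.map_bijective X Y)
  exact
    { faithful := ⟨fun {X Y} ↦ (bij X Y).1⟩
      full := ⟨fun {X Y} ↦ (bij X Y).2⟩
      essSurj := ⟨fun Z ↦ by
        have := Localization.essSurj ι.essImage.trW.Q ι.essImage.trW
        obtain ⟨Y, s, hY, hs⟩ := exists_trW_of_leftAdjoint adj (ι.essImage.trW.Q.objPreimage Z)
        exact ⟨⟨Y, hY⟩, ⟨Localization.isoOfHom ι.essImage.trW.Q _ s hs ≪≫
          ι.essImage.trW.Q.objObjPreimageIso Z⟩⟩⟩ }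

/-- If the inclusion of a triangulated subcategory has a right adjoint, then the kernel of the
right adjoint is equivalent to the Verdier quotient. -/
theorem isEquivalence_of_rightAdjoint (adj : ι ⊣ L) (P : ObjectProperty T) (hP : L.kernel = P) :
    P.IsTriangulated ∧ (P.ι ⋙ ι.essImage.trW.Q).IsEquivalence := by
  rw [kernel_rightAdjoint_eq_rightOrthogonal adj] at hP
  subst hP
  refine ⟨inferInstance, ?_⟩
  have bij : ∀ X Y : ι.essImage.rightOrthogonal.FullSubcategory, Function.Bijective
      ((ι.essImage.rightOrthogonal.ι ⋙ ι.essImage.trW.Q).map : (X ⟶ Y) → _) := fun X Y ↦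
    (Y.property.map_bijective_of_isTriangulated ι.essImage.trW.Q X.obj).comp
      (ι.essImage.rightOrthogonal.fullyFaithfulι.map_bijective X Y)
  exact
    { faithful := ⟨fun {X Y} ↦ (bij X Y).1⟩
      full := ⟨fun {X Y} ↦ (bij X Y).2⟩
      essSurj := ⟨fun Z ↦ by
        have := Localization.essSurj ι.essImage.trW.Q ι.essImage.trW
        obtain ⟨Y, s, hY, hs⟩ := exists_trW_of_rightAdjoint adj (ι.essImage.trW.Q.objPreimage Z)
        exact ⟨⟨Y, hY⟩, ⟨(Localization.isoOfHom ι.essImage.trW.Q _ s hs).symm ≪≫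
          ι.essImage.trW.Q.objObjPreimageIso Z⟩⟩⟩ }

end Verdier

/-! ### Functorial resolutions of unbounded complexes -/

section Resolutions

variable {A : Type*} [Category* A] [Abelian A]

section LeftResolution

variable {T : A ⥤ A} (ε : T ⟶ 𝟭 A)

/-- The objects of the complex `leftRes ε X`. -/
abbrev leftResX (X : CochainComplex A ℤ) (n : ℤ) : A :=
  pullback (ε.app (X.X (n + 1))) (ε.app (X.X n) ≫ X.d n (n + 1))

/-- The differential of the complex `leftRes ε X`. -/
def leftResD (X : CochainComplex A ℤ) (n : ℤ) : leftResX ε X n ⟶ leftResX ε X (n + 1) :=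
  pullback.lift 0 (pullback.fst _ _) (by
    rw [zero_comp, pullback.condition_assoc, Category.assoc, X.d_comp_d, comp_zero, comp_zero])

/-- Let `ε : T ⟶ 𝟭 A` be a natural epimorphism. For a complex `X`, the objects
`T(X^n) ⊞ T(X^{n-1})` form a contractible complex `P` with an epimorphism `P ⟶ X`, and
`leftRes ε X` is the shift by `1` of the kernel of `P ⟶ X`. In degree `n`, it is the fibre
product of `T(X^{n+1})` and `T(X^n)` over `X^{n+1}`, and its differential is `(a, b) ↦ (0, a)`.
Hence it is quasi-isomorphic
to `X`. The functor `T` need not be additive. -/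
def leftRes (X : CochainComplex A ℤ) : CochainComplex A ℤ :=
  CochainComplex.of (leftResX ε X) (leftResD ε X)
    (fun n ↦ pullback.hom_ext
      (by rw [leftResD, leftResD, Category.assoc, pullback.lift_fst, comp_zero, zero_comp])
      (by rw [leftResD, leftResD, Category.assoc, pullback.lift_snd, pullback.lift_fst, zero_comp]))

namespace leftRes

variable (X Y : CochainComplex A ℤ) (n : ℤ)

/-- The projection `(a, b) ↦ a`. -/
def fst : (leftRes ε X).X n ⟶ T.obj (X.X (n + 1)) :=
  pullback.fst (ε.app (X.X (n + 1))) (ε.app (X.X n) ≫ X.d n (n + 1))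

/-- The projection `(a, b) ↦ b`. -/
def snd : (leftRes ε X).X n ⟶ T.obj (X.X n) :=
  pullback.snd (ε.app (X.X (n + 1))) (ε.app (X.X n) ≫ X.d n (n + 1))

lemma condition : fst ε X n ≫ ε.app (X.X (n + 1)) = snd ε X n ≫ ε.app (X.X n) ≫ X.d n (n + 1) :=
  pullback.condition

variable {X n} in
/-- The morphism to `leftRes ε X` with the given components. -/
def lift {Z : A} (a : Z ⟶ T.obj (X.X (n + 1))) (b : Z ⟶ T.obj (X.X n))
    (h : a ≫ ε.app (X.X (n + 1)) = b ≫ ε.app (X.X n) ≫ X.d n (n + 1)) :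
    Z ⟶ (leftRes ε X).X n :=
  pullback.lift a b h

section

variable {Z : A} (a : Z ⟶ T.obj (X.X (n + 1))) (b : Z ⟶ T.obj (X.X n))
    (h : a ≫ ε.app (X.X (n + 1)) = b ≫ ε.app (X.X n) ≫ X.d n (n + 1))

@[simp]
lemma lift_fst : lift ε a b h ≫ fst ε X n = a := pullback.lift_fst _ _ _

@[simp]
lemma lift_fst_assoc {W : A} (g : T.obj (X.X (n + 1)) ⟶ W) :
    lift ε a b h ≫ fst ε X n ≫ g = a ≫ g := by
  rw [← Category.assoc, lift_fst]

@[simp]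
lemma lift_snd : lift ε a b h ≫ snd ε X n = b := pullback.lift_snd _ _ _

@[simp]
lemma lift_snd_assoc {W : A} (g : T.obj (X.X n) ⟶ W) :
    lift ε a b h ≫ snd ε X n ≫ g = b ≫ g := by
  rw [← Category.assoc, lift_snd]

end

variable {X n} in
lemma hom_ext {Z : A} {g h : Z ⟶ (leftRes ε X).X n} (h₁ : g ≫ fst ε X n = h ≫ fst ε X n)
    (h₂ : g ≫ snd ε X n = h ≫ snd ε X n) : g = h :=
  pullback.hom_ext h₁ h₂

@[simp]
lemma d_fst : (leftRes ε X).d n (n + 1) ≫ fst ε X (n + 1) = 0 := by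
  refine (congr($(CochainComplex.of_d (leftResX ε X) (leftResD ε X) n) ≫ fst ε X (n + 1))).trans ?_
  exact pullback.lift_fst _ _ _

@[simp]
lemma d_fst_assoc {W : A} (g : T.obj (X.X (n + 1 + 1)) ⟶ W) :
    (leftRes ε X).d n (n + 1) ≫ fst ε X (n + 1) ≫ g = 0 := by
  rw [← Category.assoc, d_fst, zero_comp]

@[simp]
lemma d_snd : (leftRes ε X).d n (n + 1) ≫ snd ε X (n + 1) = fst ε X n := by
  refine (congr($(CochainComplex.of_d (leftResX ε X) (leftResD ε X) n) ≫ snd ε X (n + 1))).trans ?_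
  exact pullback.lift_snd _ _ _

@[simp]
lemma d_snd_assoc {W : A} (g : T.obj (X.X (n + 1)) ⟶ W) :
    (leftRes ε X).d n (n + 1) ≫ snd ε X (n + 1) ≫ g = fst ε X n ≫ g := by
  rw [← Category.assoc, d_snd]

variable {X Y} in
/-- The functoriality of `leftRes`. -/
@[simps]
def map (φ : X ⟶ Y) : leftRes ε X ⟶ leftRes ε Y where
  f n := lift ε (fst ε X n ≫ T.map (φ.f (n + 1))) (snd ε X n ≫ T.map (φ.f n))
    (by
      have h₁ := ε.naturality (φ.f (n + 1))
      have h₂ := ε.naturality (φ.f n)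
      dsimp at h₁ h₂
      rw [Category.assoc, Category.assoc, h₁, reassoc_of% h₂, reassoc_of% condition ε X n, φ.comm])
  comm' := by
    rintro n _ rfl
    apply hom_ext <;> simp

/-- The canonical morphism `leftRes ε X ⟶ X`. -/
@[simps]
def π : leftRes ε X ⟶ X where
  f n := snd ε X n ≫ ε.app (X.X n)
  comm' := by
    rintro n _ rfl
    rw [d_snd_assoc, condition, Category.assoc]

end leftRes

/-- The functor `X ↦ leftRes ε X`. -/
@[simps]
def leftResFunctor : CochainComplex A ℤ ⥤ CochainComplex A ℤ where
  obj := leftRes ε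
  map φ := leftRes.map ε φ
  map_id X := by
    ext n
    apply leftRes.hom_ext <;> simp
  map_comp φ ψ := by
    ext n
    apply leftRes.hom_ext <;> simp

/-- The natural transformation `leftRes ε X ⟶ X`. -/
@[simps]
def leftResNatTrans : leftResFunctor ε ⟶ 𝟭 _ where
  app := leftRes.π ε
  naturality X Y φ := by
    refine HomologicalComplex.hom_ext _ _ fun n ↦ ?_
    change (leftRes.map ε φ).f n ≫ (leftRes.π ε Y).f n = (leftRes.π ε X).f n ≫ φ.f n
    simp

instance quasiIso_leftResπ [∀ X, Epi (ε.app X)] (X : CochainComplex A ℤ) :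
    QuasiIso (leftRes.π ε X) := by
  refine ⟨fun n ↦ (quasiIsoAt_iff_isIso_homologyMap _ _).2 ?_⟩
  obtain ⟨m, rfl⟩ : ∃ m : ℤ, n = m + 1 := ⟨n - 1, by simp⟩
  have h₁ : (ComplexShape.up ℤ).prev (m + 1) = m := by simp
  have h₂ : (ComplexShape.up ℤ).next (m + 1) = m + 1 + 1 := by simp
  have h₃ : Mono (HomologicalComplex.homologyMap (leftRes.π ε X) (m + 1)) := by
    rw [HomologicalComplex.mono_homologyMap_iff_up_to_refinements _ m (m + 1) (m + 1 + 1) h₁ h₂]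
    intro B x hx y hy
    -- a cycle is of the form `(0, b)`; if `ε b = d (ε b')`, it is the boundary of `(b, b')`
    obtain ⟨B', π, hπ, b, hb⟩ := surjective_up_to_refinements_of_epi (ε.app (X.X m)) y
    have hx' : x ≫ leftRes.fst _ _ _ = 0 := by
      have := hx =≫ leftRes.snd _ _ _
      rwa [Category.assoc, leftRes.d_snd, zero_comp] at this
    refine ⟨B', π, hπ, leftRes.lift ε (π ≫ x ≫ leftRes.snd _ _ _) b ?_, ?_⟩
    · simp only [leftRes.π_f] at hy
      dsimp at hb
      rw [Category.assoc, Category.assoc, hy, reassoc_of% hb]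
    · apply leftRes.hom_ext
      · simp [hx']
      · simp
  have h₄ : Epi (HomologicalComplex.homologyMap (leftRes.π ε X) (m + 1)) := by
    rw [HomologicalComplex.epi_homologyMap_iff_up_to_refinements _ m (m + 1) (m + 1 + 1) h₁ h₂]
    intro B y hy
    obtain ⟨B', π, hπ, b, hb⟩ := surjective_up_to_refinements_of_epi (ε.app (X.X (m + 1))) y
    dsimp at hb
    refine ⟨B', π, hπ, leftRes.lift ε 0 b ?_, ?_, 0, ?_⟩
    · rw [zero_comp, ← reassoc_of% hb, hy, comp_zero]
    · apply leftRes.hom_ext <;> simp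
    · simp [hb]
  exact isIso_of_mono_of_epi _

end LeftResolution

section RightResolution

variable {T : A ⥤ A} (η : 𝟭 A ⟶ T)

/-- For generalized elements, a pushout square in an abelian category is a weak pullback. -/
lemma exists_refinement_of_isPushout {X₁ X₂ X₃ X₄ : A} {t : X₁ ⟶ X₂} {l : X₁ ⟶ X₃}
    {r : X₂ ⟶ X₄} {b : X₃ ⟶ X₄} (h : IsPushout t l r b) {B : A} (x₂ : B ⟶ X₂) (x₃ : B ⟶ X₃)
    (hx : x₂ ≫ r = x₃ ≫ b) :
    ∃ (B' : A) (π : B' ⟶ B) (_ : Epi π) (x : B' ⟶ X₁), π ≫ x₂ = x ≫ t ∧ π ≫ x₃ = x ≫ l := by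
  have h₀ : ∀ ⦃C : A⦄ (y : C ⟶ X₂ ⊞ X₃), y ≫ biprod.desc r b = 0 →
      ∃ (C' : A) (π : C' ⟶ C) (_ : Epi π) (x : C' ⟶ X₁), π ≫ y = x ≫ biprod.lift t (-l) :=
    fun _ y hy ↦ h.exact_shortComplex.exact_up_to_refinements y hy
  obtain ⟨B', π, hπ, x, hx'⟩ := h₀ (biprod.lift x₂ (-x₃)) (by simp [hx])
  refine ⟨B', π, hπ, x, ?_, ?_⟩
  · simpa using hx' =≫ biprod.fst
  · simpa using hx' =≫ biprod.snd

/-- The object `X^n`, with the index written as `n + 1 - 1`. -/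
abbrev XSuccPredIso (X : CochainComplex A ℤ) (n : ℤ) : X.X n ≅ X.X (n + 1 - 1) :=
  X.XIsoOfEq (by lia)

/-- The objects of the complex `rightRes η X`. -/
abbrev rightResX (X : CochainComplex A ℤ) (n : ℤ) : A :=
  pushout (η.app (X.X (n - 1))) (X.d (n - 1) n ≫ η.app (X.X n))

/-- The differential of the complex `rightRes η X`. -/
def rightResD (X : CochainComplex A ℤ) (n : ℤ) : rightResX η X n ⟶ rightResX η X (n + 1) :=
  pushout.desc 0 (T.map (XSuccPredIso X n).hom ≫ pushout.inl _ _) (by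
    have h := η.naturality (XSuccPredIso X n).hom
    dsimp at h
    rw [comp_zero, Category.assoc, ← reassoc_of% h, pushout.condition,
      HomologicalComplex.d_comp_XIsoOfEq_hom_assoc, Category.assoc, X.d_comp_d_assoc, zero_comp])

/-- Let `η : 𝟭 A ⟶ T` be a natural monomorphism. For a complex `X`, the objects
`T(X^n) ⊞ T(X^{n+1})` form a contractible complex `I` with a monomorphism `X ⟶ I`, and
`rightRes η X` is the shift by `-1` of its cokernel. In degree `n`, it is the pushout of
`T(X^{n-1})` and `T(X^n)` under `X^{n-1}`, and its differential is zero on the first summand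
and the inclusion of `T(X^n)` on the second one. Hence it is
quasi-isomorphic to `X`. The functor `T` need not be additive. -/
def rightRes (X : CochainComplex A ℤ) : CochainComplex A ℤ :=
  CochainComplex.of (rightResX η X) (rightResD η X)
    (fun n ↦ pushout.hom_ext
      (by rw [rightResD, rightResD, pushout.inl_desc_assoc, comp_zero, zero_comp])
      (by rw [rightResD, rightResD, pushout.inr_desc_assoc, Category.assoc, pushout.inl_desc,
        comp_zero, comp_zero]))

namespace rightRes

variable (X Y : CochainComplex A ℤ) (n : ℤ)

/-- The inclusion of `T(X^{n-1})`. -/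
def inl : T.obj (X.X (n - 1)) ⟶ (rightRes η X).X n :=
  pushout.inl (η.app (X.X (n - 1))) (X.d (n - 1) n ≫ η.app (X.X n))

/-- The inclusion of `T(X^n)`. -/
def inr : T.obj (X.X n) ⟶ (rightRes η X).X n :=
  pushout.inr (η.app (X.X (n - 1))) (X.d (n - 1) n ≫ η.app (X.X n))

lemma isPushout : IsPushout (η.app (X.X (n - 1))) (X.d (n - 1) n ≫ η.app (X.X n))
    (inl η X n) (inr η X n) :=
  IsPushout.of_hasPushout _ _

lemma condition : η.app (X.X (n - 1)) ≫ inl η X n = X.d (n - 1) n ≫ η.app (X.X n) ≫ inr η X n :=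
  (isPushout η X n).w.trans (Category.assoc _ _ _)

variable {X n} in
/-- The morphism from `rightRes η X` with the given components. -/
def desc {Z : A} (a : T.obj (X.X (n - 1)) ⟶ Z) (b : T.obj (X.X n) ⟶ Z)
    (h : η.app (X.X (n - 1)) ≫ a = X.d (n - 1) n ≫ η.app (X.X n) ≫ b) :
    (rightRes η X).X n ⟶ Z :=
  pushout.desc a b (by simpa using h)

section

variable {Z : A} (a : T.obj (X.X (n - 1)) ⟶ Z) (b : T.obj (X.X n) ⟶ Z)
    (h : η.app (X.X (n - 1)) ≫ a = X.d (n - 1) n ≫ η.app (X.X n) ≫ b)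

@[simp]
lemma inl_desc : inl η X n ≫ desc η a b h = a := pushout.inl_desc _ _ _

@[simp]
lemma inl_desc_assoc {W : A} (g : Z ⟶ W) : inl η X n ≫ desc η a b h ≫ g = a ≫ g := by
  rw [← Category.assoc, inl_desc]

@[simp]
lemma inr_desc : inr η X n ≫ desc η a b h = b := pushout.inr_desc _ _ _

@[simp]
lemma inr_desc_assoc {W : A} (g : Z ⟶ W) : inr η X n ≫ desc η a b h ≫ g = b ≫ g := by
  rw [← Category.assoc, inr_desc]

end

variable {X n} in
lemma hom_ext {Z : A} {g h : (rightRes η X).X n ⟶ Z} (h₁ : inl η X n ≫ g = inl η X n ≫ h)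
    (h₂ : inr η X n ≫ g = inr η X n ≫ h) : g = h :=
  pushout.hom_ext h₁ h₂

@[simp]
lemma inl_d : inl η X n ≫ (rightRes η X).d n (n + 1) = 0 := by
  refine (congr(inl η X n ≫ $(CochainComplex.of_d (rightResX η X) (rightResD η X) n))).trans ?_
  exact pushout.inl_desc _ _ _

@[simp]
lemma inl_d_assoc {W : A} (g : (rightRes η X).X (n + 1) ⟶ W) :
    inl η X n ≫ (rightRes η X).d n (n + 1) ≫ g = 0 := by
  rw [← Category.assoc, inl_d, zero_comp]

@[simp]
lemma inr_d : inr η X n ≫ (rightRes η X).d n (n + 1) =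
    T.map (XSuccPredIso X n).hom ≫ inl η X (n + 1) := by
  refine (congr(inr η X n ≫ $(CochainComplex.of_d (rightResX η X) (rightResD η X) n))).trans ?_
  exact pushout.inr_desc _ _ _

@[simp]
lemma inr_d_assoc {W : A} (g : (rightRes η X).X (n + 1) ⟶ W) :
    inr η X n ≫ (rightRes η X).d n (n + 1) ≫ g =
      T.map (XSuccPredIso X n).hom ≫ inl η X (n + 1) ≫ g := by
  rw [← Category.assoc, inr_d, Category.assoc]

variable {X Y} in
/-- The functoriality of `rightRes`. -/
@[simps]
def map (φ : X ⟶ Y) : rightRes η X ⟶ rightRes η Y where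
  f n := desc η (T.map (φ.f (n - 1)) ≫ inl η Y n) (T.map (φ.f n) ≫ inr η Y n)
    (by
      have h₁ := η.naturality (φ.f (n - 1))
      have h₂ := η.naturality (φ.f n)
      dsimp at h₁ h₂
      rw [← reassoc_of% h₁, ← reassoc_of% h₂, condition, φ.comm_assoc])
  comm' := by
    rintro n _ rfl
    apply hom_ext
    · simp
    · have h := T.congr_map
        (HomologicalComplex.XIsoOfEq_hom_naturality φ (show n = n + 1 - 1 by lia))
      simp only [Functor.map_comp] at h
      simp [reassoc_of% h]

/-- The canonical morphism `X ⟶ rightRes η X`. -/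
@[simps]
def ι : X ⟶ rightRes η X where
  f n := η.app (X.X n) ≫ inr η X n
  comm' := by
    rintro n _ rfl
    have h := η.naturality (XSuccPredIso X n).hom
    dsimp at h
    rw [Category.assoc, inr_d, ← reassoc_of% h, condition]
    simp

end rightRes

/-- The functor `X ↦ rightRes η X`. -/
@[simps]
def rightResFunctor : CochainComplex A ℤ ⥤ CochainComplex A ℤ where
  obj := rightRes η
  map φ := rightRes.map η φ
  map_id X := by
    ext n
    apply rightRes.hom_ext <;> simp
  map_comp φ ψ := by
    ext n
    apply rightRes.hom_ext <;> simp

/-- The natural transformation `X ⟶ rightRes η X`. -/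
@[simps]
def rightResNatTrans : 𝟭 _ ⟶ rightResFunctor η where
  app := rightRes.ι η
  naturality X Y φ := by
    refine HomologicalComplex.hom_ext _ _ fun n ↦ ?_
    change φ.f n ≫ (rightRes.ι η Y).f n = (rightRes.ι η X).f n ≫ (rightRes.map η φ).f n
    have h := η.naturality (φ.f n)
    dsimp at h
    simp [reassoc_of% h]

instance quasiIso_rightResι [∀ X, Mono (η.app X)] (X : CochainComplex A ℤ) :
    QuasiIso (rightRes.ι η X) := by
  refine ⟨fun n ↦ (quasiIsoAt_iff_isIso_homologyMap _ _).2 ?_⟩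
  obtain ⟨m, rfl⟩ : ∃ m : ℤ, n = m + 1 := ⟨n - 1, by simp⟩
  have h₁ : (ComplexShape.up ℤ).prev (m + 1) = m := by simp
  have h₂ : (ComplexShape.up ℤ).next (m + 1) = m + 1 + 1 := by simp
  have hη (n : ℤ) := η.naturality (XSuccPredIso X n).hom
  simp only [Functor.id_map, Functor.id_obj] at hη
  have h₃ : Mono (HomologicalComplex.homologyMap (rightRes.ι η X) (m + 1)) := by
    rw [HomologicalComplex.mono_homologyMap_iff_up_to_refinements _ m (m + 1) (m + 1 + 1) h₁ h₂]
    intro B x hx y hy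
    rw [rightRes.ι_f] at hy
    obtain ⟨B₁, π₁, _, b, a, hba⟩ :=
      (rightRes.isPushout η X m).hom_eq_add_up_to_refinements y
    obtain ⟨B₂, π₂, _, x₁, e₁, e₂⟩ := exists_refinement_of_isPushout
      (rightRes.isPushout η X (m + 1)) (a ≫ T.map (XSuccPredIso X m).hom)
      (π₁ ≫ x ≫ η.app (X.X (m + 1))) (by
        have := hba =≫ (rightRes η X).d m (m + 1)
        simpa [← hy] using this.symm)
    refine ⟨B₂, π₂ ≫ π₁, inferInstance, x₁ ≫ (XSuccPredIso X m).inv, ?_⟩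
    rw [← cancel_mono (η.app (X.X (m + 1)))]
    simpa using e₂
  have h₄ : Epi (HomologicalComplex.homologyMap (rightRes.ι η X) (m + 1)) := by
    rw [HomologicalComplex.epi_homologyMap_iff_up_to_refinements _ m (m + 1) (m + 1 + 1) h₁ h₂]
    intro B y hy
    obtain ⟨B₁, π₁, _, b, a, hba⟩ :=
      (rightRes.isPushout η X (m + 1)).hom_eq_add_up_to_refinements y
    obtain ⟨B₂, π₂, _, x₁, e₁, e₂⟩ := exists_refinement_of_isPushout
      (rightRes.isPushout η X (m + 1 + 1)) (a ≫ T.map (XSuccPredIso X (m + 1)).hom) 0 (by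
        have := hba =≫ (rightRes η X).d (m + 1) (m + 1 + 1)
        simpa [hy] using this.symm)
    have e₃ : π₂ ≫ a = (x₁ ≫ (XSuccPredIso X (m + 1)).inv) ≫ η.app (X.X (m + 1)) := by
      rw [← cancel_mono (T.map (XSuccPredIso X (m + 1)).hom), Category.assoc, e₁]
      simp [← hη]
    refine ⟨B₂, π₂ ≫ π₁, inferInstance, x₁ ≫ (XSuccPredIso X (m + 1)).inv, ?_,
      π₂ ≫ b ≫ T.map (XSuccPredIso X m).inv ≫ rightRes.inr η X m, ?_⟩
    · rw [← cancel_mono (η.app (X.X (m + 1 + 1)))]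
      simpa using e₂.symm
    · rw [Category.assoc, hba]
      simp [reassoc_of% e₃, ← Functor.map_comp_assoc, add_comm]
  exact isIso_of_mono_of_epi _

end RightResolution

end Resolutions

/-! ### Acyclicity of the image of a complex under a one-sided exact functor -/

section Acyclicity

variable {A B : Type*} [Category* A] [Abelian A] [Category* B] [Abelian B]

lemma acyclic_mappingCone_iff {X Y : CochainComplex A ℤ} (φ : X ⟶ Y) :
    (CochainComplex.mappingCone φ).Acyclic ↔ QuasiIso φ := by
  rw [← HomologicalComplex.mem_quasiIso_iff, ← HomotopyCategory.quotient_map_mem_quasiIso_iff,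
    HomotopyCategory.quasiIso_eq_trW_subcategoryAcyclic]
  exact ((HomotopyCategory.quotient_obj_mem_subcategoryAcyclic_iff_acyclic _).symm.trans
    ((HomotopyCategory.subcategoryAcyclic A).trW_iff_of_distinguished _
      (HomotopyCategory.mappingCone_triangleh_distinguished φ)).symm)

/-- If an additive functor preserves the acyclicity of the complexes with terms in a class of
objects, then it preserves the quasi-isomorphisms between such complexes. -/
lemma quasiIso_map_of_acyclic_map (F : A ⥤ B) [F.Additive] (P : ObjectProperty A)
    [P.IsClosedUnderIsomorphisms] (hP : ∀ M N, P M → P N → P (M ⊞ N))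
    (hF : ∀ X : CochainComplex A ℤ, (∀ n, P (X.X n)) → X.Acyclic →
      ((F.mapHomologicalComplex (.up ℤ)).obj X).Acyclic)
    {X Y : CochainComplex A ℤ} (φ : X ⟶ Y) (hX : ∀ n, P (X.X n)) (hY : ∀ n, P (Y.X n))
    (hφ : QuasiIso φ) : QuasiIso ((F.mapHomologicalComplex (.up ℤ)).map φ) := by
  rw [← acyclic_mappingCone_iff] at hφ ⊢
  intro n
  exact (hF _ (fun n ↦ P.prop_of_iso
    (HomologicalComplex.homotopyCofiber.XIsoBiprod φ n (n + 1) rfl).symm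
      (hP _ _ (hX _) (hY _))) hφ n).of_iso (CochainComplex.mappingCone.mapHomologicalComplexIso φ F)

/-- The exactness of `X₁ ⟶ X₂ ⟶ X₃` at `X₂`, when the two morphisms factor as an epimorphism,
a morphism `k` resp. `k'`, and a monomorphism, such that the middle sequence `Q ⟶ X₂ ⟶ P'` is
exact. -/
lemma exact_iff_of_factorization {X₁ X₂ X₃ P Q P' Q' : A} (f : X₁ ⟶ X₂) (g : X₂ ⟶ X₃)
    (hfg : f ≫ g = 0) (e : X₁ ⟶ P) (k : P ⟶ Q) (i : Q ⟶ X₂) (p : X₂ ⟶ P') (k' : P' ⟶ Q')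
    (i' : Q' ⟶ X₃) [Epi e] [Mono i] [Epi p] [Mono i'] (hf : e ≫ k ≫ i = f)
    (hg : p ≫ k' ≫ i' = g) (w : i ≫ p = 0) (h : (ShortComplex.mk i p w).Exact) :
    (ShortComplex.mk f g hfg).Exact ↔ Epi k ∧ Mono k' := by
  subst hf hg
  constructor
  · intro hS
    constructor
    · rw [epi_iff_surjective_up_to_refinements]
      intro C q
      obtain ⟨C', π, hπ, x, hx⟩ := hS.exact_up_to_refinements (q ≫ i)
        (by rw [Category.assoc, reassoc_of% w, zero_comp, comp_zero])
      refine ⟨C', π, hπ, x ≫ e, ?_⟩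
      rw [← cancel_mono i]
      simpa using hx
    · rw [Preadditive.mono_iff_cancel_zero]
      intro C y hy
      obtain ⟨C₁, π₁, hπ₁, x, hx⟩ := surjective_up_to_refinements_of_epi p y
      obtain ⟨C₂, π₂, hπ₂, z, hz⟩ := hS.exact_up_to_refinements x
        (by rw [← reassoc_of% hx, reassoc_of% hy, zero_comp, comp_zero])
      rw [← cancel_epi π₁, ← cancel_epi π₂, hx, reassoc_of% hz]
      simp [w]
  · rintro ⟨_, _⟩
    rw [ShortComplex.exact_iff_exact_up_to_refinements]
    intro C x hx
    obtain ⟨C₁, π₁, hπ₁, q, hq⟩ := h.exact_up_to_refinements x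
      (by
        rw [← cancel_mono k', ← cancel_mono i']
        simpa using hx)
    obtain ⟨C₂, π₂, hπ₂, y, hy⟩ := surjective_up_to_refinements_of_epi (e ≫ k) q
    refine ⟨C₂, π₂ ≫ π₁, inferInstance, y, ?_⟩
    dsimp at hq
    rw [Category.assoc, hq, reassoc_of% hy]

variable (X : CochainComplex A ℤ) (n m : ℤ)

/-- The boundaries in degree `n`, as a subobject of the cycles. -/
abbrev boundaries : A := kernel (X.homologyπ n)

/-- The differential, with values in the boundaries. -/
def toBoundaries : X.X n ⟶ boundaries X m := kernel.lift _ (X.toCycles n m) (by simp)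

@[simp]
lemma toBoundaries_ι_iCycles :
    toBoundaries X n m ≫ kernel.ι (X.homologyπ m) ≫ X.iCycles m = X.d n m := by
  simp [toBoundaries]

lemma epi_toBoundaries (h : n + 1 = m) : Epi (toBoundaries X n m) := by
  have h₁ : (ComplexShape.up ℤ).prev m = n := by simp [← h]
  exact (ShortComplex.exact_of_g_is_cokernel (.mk (X.toCycles n m) (X.homologyπ m) (by simp))
    (X.homologyIsCokernel n m h₁)).epi_kernelLift

lemma iCycles_toBoundaries : X.iCycles n ≫ toBoundaries X n m = 0 := by
  rw [← cancel_mono (kernel.ι (X.homologyπ m)), ← cancel_mono (X.iCycles m)]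
  simp

lemma shortExact_cycles_boundaries (h : n + 1 = m) :
    (ShortComplex.mk (X.iCycles n) (toBoundaries X n m)
      (iCycles_toBoundaries X n m)).ShortExact := by
  have := epi_toBoundaries X n m h
  refine ShortComplex.ShortExact.mk ?_
  rw [ShortComplex.exact_iff_exact_up_to_refinements]
  intro C x hx
  dsimp at x hx ⊢
  refine ⟨C, 𝟙 C, inferInstance, X.liftCycles x m (by simp [← h]) ?_, ?_⟩
  · rw [← toBoundaries_ι_iCycles, reassoc_of% hx, zero_comp]
  · rw [X.liftCycles_i, Category.id_comp]

lemma shortExact_boundaries_homology :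
    (ShortComplex.mk (kernel.ι (X.homologyπ n)) (X.homologyπ n)
      (kernel.condition _)).ShortExact where
  exact := ShortComplex.exact_kernel _

/-- The image of the differential, as a quotient of the opcycles. -/
abbrev coboundaries : A := cokernel (X.homologyι n)

/-- The map from the quotient `coboundaries` of the opcycles induced by the differential. -/
def fromCoboundaries : coboundaries X n ⟶ X.X m := cokernel.desc _ (X.fromOpcycles n m) (by simp)

@[simp]
lemma pOpcycles_π_fromCoboundaries :
    X.pOpcycles n ≫ cokernel.π (X.homologyι n) ≫ fromCoboundaries X n m = X.d n m := by
  simp [fromCoboundaries]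

@[simp]
lemma pOpcycles_π_fromCoboundaries_assoc {W : A} (g : X.X m ⟶ W) :
    X.pOpcycles n ≫ cokernel.π (X.homologyι n) ≫ fromCoboundaries X n m ≫ g = X.d n m ≫ g := by
  rw [← pOpcycles_π_fromCoboundaries X n m, Category.assoc, Category.assoc]

lemma mono_fromCoboundaries (h : n + 1 = m) : Mono (fromCoboundaries X n m) := by
  have h₁ : (ComplexShape.up ℤ).next n = m := by simp [← h]
  exact (ShortComplex.exact_of_f_is_kernel (.mk (X.homologyι n) (X.fromOpcycles n m) (by simp))
    (X.homologyIsKernel n m h₁)).mono_cokernelDesc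

lemma fromCoboundaries_pOpcycles : fromCoboundaries X n m ≫ X.pOpcycles m = 0 := by
  rw [← cancel_epi (cokernel.π (X.homologyι n)), ← cancel_epi (X.pOpcycles n)]
  simp

lemma shortExact_coboundaries_opcycles (h : n + 1 = m) :
    (ShortComplex.mk (fromCoboundaries X n m) (X.pOpcycles m)
      (fromCoboundaries_pOpcycles X n m)).ShortExact := by
  have := mono_fromCoboundaries X n m h
  have h₁ : (ComplexShape.up ℤ).prev m = n := by simp [← h]
  refine ShortComplex.ShortExact.mk ?_
  have := ShortComplex.exact_of_g_is_cokernel (.mk (X.d n m) (X.pOpcycles m) (by simp))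
    (X.opcyclesIsCokernel n m h₁)
  rw [ShortComplex.exact_iff_exact_up_to_refinements] at this ⊢
  intro C x hx
  obtain ⟨C', π, hπ, y, hy⟩ := this x hx
  refine ⟨C', π, hπ, y ≫ X.pOpcycles n ≫ cokernel.π _, ?_⟩
  simpa using hy

lemma shortExact_homology_coboundaries :
    (ShortComplex.mk (X.homologyι n) (cokernel.π (X.homologyι n))
      (cokernel.condition _)).ShortExact where
  exact := ShortComplex.exact_cokernel _

/-- Let `F` be a right exact functor. If `F` preserves the monomorphisms `Z^i ⟶ X^i` for
`i = n, m`, then the exactness of `F X` in degree `n` is expressed in terms of the values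
of `F` on `B^n ⟶ Z^n` and `B^{n+1} ⟶ Z^{n+1}`. -/
lemma exactAt_map_iff_of_mono_map (F : A ⥤ B) [F.Additive] [PreservesFiniteColimits F]
    (h : n + 1 = m) [Mono (F.map (X.iCycles n))] [Mono (F.map (X.iCycles m))] :
    ((F.mapHomologicalComplex (.up ℤ)).obj X).ExactAt n ↔
      Epi (F.map (kernel.ι (X.homologyπ n))) ∧ Mono (F.map (kernel.ι (X.homologyπ m))) := by
  have := epi_toBoundaries X (n - 1) n (by lia)
  have := epi_toBoundaries X n m h
  rw [HomologicalComplex.exactAt_iff' _ (n - 1) n m (by simp) (by simp [h])]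
  exact exact_iff_of_factorization (F.map (X.d (n - 1) n)) (F.map (X.d n m))
    (by rw [← F.map_comp, X.d_comp_d, F.map_zero]) (F.map (toBoundaries X (n - 1) n)) _
    (F.map (X.iCycles n)) (F.map (toBoundaries X n m)) _ (F.map (X.iCycles m))
    (by simp only [← F.map_comp, toBoundaries_ι_iCycles])
    (by simp only [← F.map_comp, toBoundaries_ι_iCycles])
    (by rw [← F.map_comp, iCycles_toBoundaries, F.map_zero])
    ((shortExact_cycles_boundaries X n m h).exact.map_of_epi_of_preservesCokernel F
      (shortExact_cycles_boundaries X n m h).epi_g inferInstance)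

/-- Let `F` be a left exact functor. If `F` preserves the epimorphisms `X^i ⟶ X^i / B^i` for
`i = n, m`, then the exactness of `F X` in degree `m` is expressed in terms of the values
of `F` on `X^n / B^n ⟶ B^m` and `X^m / B^m ⟶ B^{m+1}`. -/
lemma exactAt_map_iff_of_epi_map (F : A ⥤ B) [F.Additive] [PreservesFiniteLimits F]
    (h : n + 1 = m) [Epi (F.map (X.pOpcycles n))] [Epi (F.map (X.pOpcycles m))] :
    ((F.mapHomologicalComplex (.up ℤ)).obj X).ExactAt m ↔
      Epi (F.map (cokernel.π (X.homologyι n))) ∧ Mono (F.map (cokernel.π (X.homologyι m))) := by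
  have := mono_fromCoboundaries X n m h
  have := mono_fromCoboundaries X m (m + 1) rfl
  rw [HomologicalComplex.exactAt_iff' _ n m (m + 1) (by simp [← h]) (by simp)]
  exact exact_iff_of_factorization (F.map (X.d n m)) (F.map (X.d m (m + 1)))
    (by rw [← F.map_comp, X.d_comp_d, F.map_zero]) (F.map (X.pOpcycles n)) _
    (F.map (fromCoboundaries X n m)) (F.map (X.pOpcycles m)) _
    (F.map (fromCoboundaries X m (m + 1)))
    (by simp only [← F.map_comp, pOpcycles_π_fromCoboundaries])
    (by simp only [← F.map_comp, pOpcycles_π_fromCoboundaries])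
    (by rw [← F.map_comp, fromCoboundaries_pOpcycles, F.map_zero])
    ((shortExact_coboundaries_opcycles X n m h).exact.map_of_mono_of_preservesKernel F
      (shortExact_coboundaries_opcycles X n m h).mono_f inferInstance)

end Acyclicity

/-! ### Vanishing of the first left derived functor of a right exact functor -/

section LeftDerived

variable {C D : Type*} [Category* C] [Abelian C] [Category* D]

/-- The exactness of a short complex, in terms of the generalized elements of its terms. -/
lemma exact_mk_iff {X₁ X₂ X₃ : C} {f : X₁ ⟶ X₂} {g : X₂ ⟶ X₃} {w : f ≫ g = 0} :
    (ShortComplex.mk f g w).Exact ↔ ∀ ⦃T : C⦄ (x : T ⟶ X₂), x ≫ g = 0 →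
      ∃ (T' : C) (π : T' ⟶ T) (_ : Epi π) (y : T' ⟶ X₁), π ≫ x = y ≫ f :=
  ShortComplex.exact_iff_exact_up_to_refinements _

/-- A morphism of extensions of the same object is given by a pushout square. -/
lemma isPushout_of_shortExact {K P M A B : C} {k : K ⟶ P} {p : P ⟶ M} {w : k ≫ p = 0}
    (hP : (ShortComplex.mk k p w).ShortExact) {i : A ⟶ B} {q : B ⟶ M} {w' : i ≫ q = 0}
    (hB : (ShortComplex.mk i q w').ShortExact) {h : K ⟶ A} {g : P ⟶ B} (hq : g ≫ q = p)
    (hh : h ≫ i = k ≫ g) : IsPushout k h g i := by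
  have : Mono i := hB.mono_f
  have : Epi p := hP.epi_g
  have sq : CommSq k h g i := ⟨hh.symm⟩
  have h₁ : (ShortComplex.mk (biprod.lift k (-h)) (biprod.desc g i) (by simp [hh])).Exact := by
    rw [exact_mk_iff]
    intro T x hx
    have hx' : (x ≫ biprod.fst) ≫ g + (x ≫ biprod.snd) ≫ i = 0 := by
      simpa [biprod.desc_eq] using hx
    obtain ⟨T', π, _, y, hy⟩ := exact_mk_iff.1 hP.exact (x ≫ biprod.fst) (by
      have := hx' =≫ q
      simpa [w', hq] using this)
    refine ⟨T', π, inferInstance, y, ?_⟩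
    apply biprod.hom_ext
    · simpa using hy
    · rw [← cancel_mono i]
      have := π ≫= hx'
      rw [Preadditive.comp_add, ← Category.assoc, hy, comp_zero, add_comm,
        ← eq_neg_iff_add_eq_zero] at this
      simpa [hh] using this
  have h₂ : Epi (biprod.desc g i) := by
    rw [epi_iff_surjective_up_to_refinements]
    intro T x
    obtain ⟨T₁, π₁, _, y, hy⟩ := surjective_up_to_refinements_of_epi p (x ≫ q)
    obtain ⟨T₂, π₂, _, z, hz⟩ := exact_mk_iff.1 hB.exact (π₁ ≫ x - y ≫ g)
      (by simp [hq, hy])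
    refine ⟨T₂, π₂ ≫ π₁, inferInstance, biprod.lift (π₂ ≫ y) z, ?_⟩
    simp [← hz]
  exact ⟨sq, ⟨sq.isColimitEquivIsColimitCokernelCofork.symm h₁.gIsCokernel⟩⟩

lemma shortExact_image_ι {X₁ X₂ X₃ Q : C} {f : X₁ ⟶ X₂} {g : X₂ ⟶ X₃} {w : f ≫ g = 0}
    (h : (ShortComplex.mk f g w).Exact) (q : X₂ ⟶ Q) (j : Q ⟶ X₃) [Epi q] [Mono j]
    (fac : q ≫ j = g) :
    (ShortComplex.mk (image.ι f) q (by
      rw [← cancel_mono j, ← cancel_epi (factorThruImage f)]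
      simp [fac, w])).ShortExact where
  exact := by
    rw [exact_mk_iff]
    intro T x hx
    obtain ⟨T', π, _, y, hy⟩ := exact_mk_iff.1 h x
      (by rw [← fac, reassoc_of% hx, zero_comp])
    refine ⟨T', π, inferInstance, y ≫ factorThruImage f, ?_⟩
    simpa using hy

variable (F : C ⥤ D)

/-- The objects `M` such that `F` preserves the monomorphisms with cokernel `M`. When `F` is
right exact and there are enough projectives, this means that the first left derived functor
of `F` vanishes at `M`. -/
def PreservesMonosOver : ObjectProperty C :=
  fun M ↦ ∀ ⦃A B : C⦄ (i : A ⟶ B) (p : B ⟶ M) (w : i ≫ p = 0),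
    (ShortComplex.mk i p w).ShortExact → Mono (F.map i)

variable {F}

/-- The class `PreservesMonosOver F` is closed under extensions. -/
lemma PreservesMonosOver.of_shortExact_left {A B M : C} {i : A ⟶ B} {p : B ⟶ M} {w : i ≫ p = 0}
    (h : (ShortComplex.mk i p w).ShortExact) (hA : PreservesMonosOver F A)
    (hM : PreservesMonosOver F M) : PreservesMonosOver F B := by
  intro K P k q w' h'
  have : Mono i := h.mono_f
  have : Epi p := h.epi_g
  have : Epi q := h'.epi_g
  have : Mono k := h'.mono_f
  -- `k` is the composition of `K ⟶ ker (P ⟶ M)`, with cokernel `A`, and of `ker (P ⟶ M) ⟶ P`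
  let k' : K ⟶ kernel (q ≫ p) := kernel.lift _ k (by rw [reassoc_of% w', zero_comp])
  let q' : kernel (q ≫ p) ⟶ A := h.exact.lift (kernel.ι _ ≫ q) (by simp)
  have hq' : q' ≫ i = kernel.ι _ ≫ q := h.exact.lift_f _ _
  have hk' : k' ≫ kernel.ι _ = k := kernel.lift_ι _ _ _
  have w'' : k' ≫ q' = 0 := by
    rw [← cancel_mono i, Category.assoc, hq', reassoc_of% hk', w', zero_comp]
  have : Mono k' := mono_of_mono_fac hk'
  have : Epi q' := by
    rw [epi_iff_surjective_up_to_refinements]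
    intro T a
    obtain ⟨T', π, _, x, hx⟩ := surjective_up_to_refinements_of_epi q (a ≫ i)
    refine ⟨T', π, inferInstance, kernel.lift _ x (by rw [← reassoc_of% hx, w]; simp), ?_⟩
    rw [← cancel_mono i]
    simp [hq', hx]
  have h₁ : (ShortComplex.mk k' q' w'').ShortExact := ⟨by
    rw [exact_mk_iff]
    intro T x hx
    obtain ⟨T', π, _, y, hy⟩ := exact_mk_iff.1 h'.exact (x ≫ kernel.ι _)
      (by
        rw [Category.assoc, ← hq', reassoc_of% hx, zero_comp])
    refine ⟨T', π, inferInstance, y, ?_⟩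
    rw [← cancel_mono (kernel.ι _)]
    simpa [hk'] using hy⟩
  have h₂ : (ShortComplex.mk (kernel.ι (q ≫ p)) (q ≫ p) (kernel.condition _)).ShortExact :=
    ⟨ShortComplex.exact_kernel _⟩
  have := hA _ _ _ h₁
  have := hM _ _ _ h₂
  rw [← hk', F.map_comp]
  infer_instance

lemma PreservesMonosOver.of_retract {A B : C} (i : A ⟶ B) (r : B ⟶ A) (hr : i ≫ r = 𝟙 A)
    (hB : PreservesMonosOver F B) : PreservesMonosOver F A := by
  intro K P k q w h
  have : Mono k := h.mono_f
  have : Epi q := h.epi_g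
  -- the pullback of `P ⟶ A` along `B ⟶ A` is an extension of `B` by `K`
  let k' : K ⟶ pullback q r := pullback.lift k 0 (by simp [w])
  have hk' : k' ≫ pullback.fst q r = k := pullback.lift_fst _ _ _
  have hk'' : k' ≫ pullback.snd q r = 0 := pullback.lift_snd _ _ _
  have : Mono k' := mono_of_mono_fac hk'
  have h₁ : (ShortComplex.mk k' (pullback.snd q r) hk'').ShortExact := ⟨by
    rw [exact_mk_iff]
    intro T x hx
    obtain ⟨T', π, _, y, hy⟩ := exact_mk_iff.1 h.exact (x ≫ pullback.fst q r)
      (by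
        rw [Category.assoc, pullback.condition, reassoc_of% hx, zero_comp])
    refine ⟨T', π, inferInstance, y, ?_⟩
    apply pullback.hom_ext
    · simpa [hk'] using hy
    · simp [hk'', hx]⟩
  -- `P` is a retract of this extension, compatibly with `K`
  let s : P ⟶ pullback q r := pullback.lift (𝟙 P) (q ≫ i) (by simp [hr])
  have hs : k ≫ s = k' := by
    apply pullback.hom_ext
    · rw [Category.assoc, pullback.lift_fst, hk', Category.comp_id]
    · rw [Category.assoc, pullback.lift_snd, hk'', reassoc_of% w, zero_comp]
  have := hB _ _ _ h₁
  rw [← hs, F.map_comp] at this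
  exact mono_of_mono (F.map k) (F.map s)

instance : (PreservesMonosOver F).IsClosedUnderIsomorphisms where
  of_iso e h := h.of_retract e.inv e.hom e.inv_hom_id

lemma PreservesMonosOver.biprod {M N : C} (hM : PreservesMonosOver F M)
    (hN : PreservesMonosOver F N) : PreservesMonosOver F (M ⊞ N) :=
  .of_shortExact_left (ShortComplex.Splitting.ofHasBinaryBiproduct M N).shortExact hM hN

lemma PreservesMonosOver.of_projective (P : C) [Projective P] : PreservesMonosOver F P := by
  intro A B i p w h
  have := (h.splittingOfProjective).isSplitMono_f
  exact inferInstanceAs (Mono (F.map i))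

variable [Abelian D] [PreservesFiniteColimits F]

/-- It suffices to test one presentation by a projective object: any other extension of `M` is a
pushout of it. -/
lemma PreservesMonosOver.of_projective_presentation {K P M : C} [Projective P] {k : K ⟶ P}
    {p : P ⟶ M} {w : k ≫ p = 0} (hP : (ShortComplex.mk k p w).ShortExact) (h : Mono (F.map k)) :
    PreservesMonosOver F M := by
  intro A B i q w' hB
  have : Epi q := hB.epi_g
  have : Mono i := hB.mono_f
  have hq : Projective.factorThru p q ≫ q = p := Projective.factorThru_comp _ _
  have sq := isPushout_of_shortExact hP hB hq
    (h := hB.exact.lift (k ≫ Projective.factorThru p q) (by simp [hq, w])) (hB.exact.lift_f _ _)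
  exact MorphismProperty.of_isPushout (P := .monomorphisms D) (sq.map F).flip h

variable [F.Additive]

/-- In a short exact sequence `0 ⟶ A ⟶ B ⟶ M ⟶ 0` such that the first left derived functor
vanishes at `B`, it vanishes at `M` if `F` preserves the monomorphism `A ⟶ B`. -/
lemma PreservesMonosOver.of_shortExact_right [EnoughProjectives C] {A B M : C} {i : A ⟶ B}
    {p : B ⟶ M} {w : i ≫ p = 0} (h : (ShortComplex.mk i p w).ShortExact)
    (hB : PreservesMonosOver F B) (hi : Mono (F.map i)) : PreservesMonosOver F M := by
  have : Mono i := h.mono_f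
  have : Epi p := h.epi_g
  let q := Projective.π B
  have h₁ : (ShortComplex.mk (kernel.ι q) q (kernel.condition _)).ShortExact :=
    ⟨ShortComplex.exact_kernel _⟩
  have h₂ : (ShortComplex.mk (kernel.ι (q ≫ p)) (q ≫ p) (kernel.condition _)).ShortExact :=
    ⟨ShortComplex.exact_kernel _⟩
  let k' : kernel q ⟶ kernel (q ≫ p) := kernel.lift _ (kernel.ι q) (by simp)
  let q' : kernel (q ≫ p) ⟶ A := h.exact.lift (kernel.ι _ ≫ q) (by simp)
  have hq' : q' ≫ i = kernel.ι _ ≫ q := h.exact.lift_f _ _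
  have hk' : k' ≫ kernel.ι _ = kernel.ι q := kernel.lift_ι _ _ _
  have w' : k' ≫ q' = 0 := by
    rw [← cancel_mono i, Category.assoc, hq', reassoc_of% hk', kernel.condition, zero_comp]
  have : Epi q' := by
    rw [epi_iff_surjective_up_to_refinements]
    intro T a
    obtain ⟨T', π, _, x, hx⟩ := surjective_up_to_refinements_of_epi q (a ≫ i)
    refine ⟨T', π, inferInstance, kernel.lift _ x (by rw [← reassoc_of% hx, w]; simp), ?_⟩
    rw [← cancel_mono i]
    simp [hq', hx]
  have h₃ : (ShortComplex.mk k' q' w').Exact := by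
    rw [exact_mk_iff]
    intro T x hx
    refine ⟨T, 𝟙 T, inferInstance, kernel.lift _ (x ≫ kernel.ι _) ?_, ?_⟩
    · rw [Category.assoc, ← hq', reassoc_of% hx, zero_comp]
    · rw [← cancel_mono (kernel.ι _)]
      simp [hk']
  have h₄ : (ShortComplex.mk (F.map k') (F.map q') (by rw [← F.map_comp, w', F.map_zero])).Exact :=
    h₃.map_of_epi_of_preservesCokernel F inferInstance inferInstance
  refine .of_projective_presentation h₂ ?_
  have := hB _ _ _ h₁
  rw [Preadditive.mono_iff_cancel_zero]
  intro T x hx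
  obtain ⟨T', π, _, y, hy⟩ := exact_mk_iff.1 h₄ x (by
    rw [← cancel_mono (F.map i), Category.assoc, ← F.map_comp, hq', F.map_comp, reassoc_of% hx,
      zero_comp, zero_comp])
  have hy' : y = 0 := by
    rw [← cancel_mono (F.map (kernel.ι q)), ← hk', F.map_comp, ← reassoc_of% hy, hx]
    simp
  rw [← cancel_epi π, hy, hy', zero_comp, comp_zero]

/-- A right exact functor preserves the exactness of `X₁ ⟶ X₂ ⟶ X₃` at `X₂` if and only if it
preserves the monomorphism from the image of `X₂ ⟶ X₃`. -/
lemma exact_map_iff_mono_map_image_ι {X₁ X₂ X₃ : C} {f : X₁ ⟶ X₂} {g : X₂ ⟶ X₃} {w : f ≫ g = 0}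
    (h : (ShortComplex.mk f g w).Exact) :
    (ShortComplex.mk (F.map f) (F.map g) (by rw [← F.map_comp, w, F.map_zero])).Exact ↔
      Mono (F.map (image.ι g)) := by
  have w' : f ≫ factorThruImage g = 0 := by
    rw [← cancel_mono (image.ι g)]
    simp [w]
  have h₁ : (ShortComplex.mk f (factorThruImage g) w').Exact := by
    rw [exact_mk_iff]
    intro T x hx
    exact exact_mk_iff.1 h x
      (by rw [← image.fac g, reassoc_of% hx, zero_comp])
  have h₂ : (ShortComplex.mk (F.map f) (F.map (factorThruImage g))
      (by rw [← F.map_comp, w', F.map_zero])).Exact :=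
    h₁.map_of_epi_of_preservesCokernel F inferInstance inferInstance
  have hg' : F.map (factorThruImage g) ≫ F.map (image.ι g) = F.map g := by
    rw [← F.map_comp, image.fac]
  constructor
  · intro h₃
    rw [Preadditive.mono_iff_cancel_zero]
    intro T y hy
    obtain ⟨T₁, π₁, _, x, hx⟩ :=
      surjective_up_to_refinements_of_epi (F.map (factorThruImage g)) y
    obtain ⟨T₂, π₂, _, z, hz⟩ := exact_mk_iff.1 h₃ x (by
      rw [← hg', ← reassoc_of% hx, hy, comp_zero])
    rw [← cancel_epi π₁, ← cancel_epi π₂, hx, reassoc_of% hz, ← F.map_comp, w']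
    simp
  · intro _
    rw [exact_mk_iff]
    intro T x hx
    exact exact_mk_iff.1 h₂ x (by
      rw [← cancel_mono (F.map (image.ι g)), Category.assoc, hg', hx, zero_comp])

lemma isZero_leftDerived_succ_iff [HasProjectiveResolutions C] {M : C}
    (P : ProjectiveResolution M) (n : ℕ) :
    IsZero ((F.leftDerived (n + 1)).obj M) ↔ Mono (F.map (image.ι (P.complex.d (n + 1) n))) := by
  rw [← exact_map_iff_mono_map_image_ι (P.exact_succ n), (P.isoLeftDerivedObj F (n + 1)).isZero_iff]
  refine (HomologicalComplex.exactAt_iff_isZero_homology _ _).symm.trans ?_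
  exact HomologicalComplex.exactAt_iff' _ (n + 2) (n + 1) n (by simp only [ChainComplex.prev]; rfl)
    (by simp)

lemma shortExact_syzygy_zero {M : C} (P : ProjectiveResolution M) :
    ∃ (p : P.complex.X 0 ⟶ M) (w : image.ι (P.complex.d 1 0) ≫ p = 0),
      (ShortComplex.mk (image.ι (P.complex.d 1 0)) p w).ShortExact := by
  let p : P.complex.X 0 ⟶ M := P.π.f 0
  have : Epi p := inferInstanceAs (Epi (P.π.f 0))
  exact ⟨p, _, shortExact_image_ι (ShortComplex.exact_of_g_is_cokernel
    (.mk (P.complex.d 1 0) p P.complex_d_comp_π_f_zero) P.isColimitCokernelCofork) p (𝟙 _)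
    (Category.comp_id _)⟩

variable [EnoughProjectives C]

lemma preservesMonosOver_iff_isZero_leftDerived (M : C) :
    PreservesMonosOver F M ↔ IsZero ((F.leftDerived 1).obj M) := by
  let P := ProjectiveResolution.of M
  obtain ⟨p, w, hP⟩ := shortExact_syzygy_zero P
  have := P.projective 0
  rw [isZero_leftDerived_succ_iff P]
  exact ⟨fun h ↦ h _ _ _ hP, fun h ↦ .of_projective_presentation hP h⟩

/-- If the second left derived functor of `F` vanishes, then the class of objects at which the
first one vanishes is closed under subobjects. -/
lemma PreservesMonosOver.of_mono (hF : ∀ M : C, IsZero ((F.leftDerived 2).obj M)) {A B : C}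
    (i : A ⟶ B) [Mono i] (hB : PreservesMonosOver F B) : PreservesMonosOver F A := by
  let P := ProjectiveResolution.of (cokernel i)
  obtain ⟨p, w, hP⟩ := shortExact_syzygy_zero P
  have h₀ := P.projective 0
  have h₁ := P.projective 1
  -- the first derived functor vanishes at the first syzygy `K` of `B / A`
  have hK : PreservesMonosOver F (image (P.complex.d 1 0)) :=
    .of_projective_presentation (shortExact_image_ι (P.exact_succ 0)
      (factorThruImage (P.complex.d 1 0)) (image.ι _) (image.fac _))
      ((isZero_leftDerived_succ_iff P 1).1 (hF _))
  -- the fibre product `E` of `P` and `B` over `B / A` is an extension of `B` by `K`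
  have : Epi p := hP.epi_g
  let k : image (P.complex.d 1 0) ⟶ pullback p (cokernel.π i) :=
    pullback.lift (image.ι (P.complex.d 1 0)) 0 (by rw [zero_comp, w])
  have hk : k ≫ pullback.fst _ _ = image.ι (P.complex.d 1 0) := pullback.lift_fst _ _ _
  have hk' : k ≫ pullback.snd _ _ = 0 := pullback.lift_snd _ _ _
  have : Mono k := mono_of_mono_fac hk
  have hE : PreservesMonosOver F (pullback p (cokernel.π i)) := by
    refine .of_shortExact_left (p := pullback.snd _ _) (w := hk') ⟨?_⟩ hK hB
    rw [exact_mk_iff]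
    intro T x hx
    obtain ⟨T', π, _, y, hy⟩ := exact_mk_iff.1 hP.exact (x ≫ pullback.fst _ _)
      (by
        rw [Category.assoc, pullback.condition, reassoc_of% hx, zero_comp])
    refine ⟨T', π, inferInstance, y, ?_⟩
    apply pullback.hom_ext
    · simpa [hk] using hy
    · simp [hk', hx]
  -- it is also an extension of the projective object `P` by `A`
  let a : A ⟶ pullback p (cokernel.π i) := pullback.lift 0 i (by simp)
  have ha : a ≫ pullback.fst _ _ = 0 := pullback.lift_fst _ _ _
  have ha' : a ≫ pullback.snd _ _ = i := pullback.lift_snd _ _ _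
  have : Mono a := mono_of_mono_fac ha'
  have h₂ : (ShortComplex.mk a (pullback.fst _ _) ha).ShortExact := ⟨by
    rw [exact_mk_iff]
    intro T x hx
    obtain ⟨T', π, _, y, hy⟩ := exact_mk_iff.1 (ShortComplex.exact_cokernel i)
      (x ≫ pullback.snd _ _) (by
        rw [Category.assoc, ← pullback.condition, reassoc_of% hx, zero_comp])
    refine ⟨T', π, inferInstance, y, ?_⟩
    apply pullback.hom_ext
    · simp [ha, hx]
    · simpa [ha'] using hy⟩
  have : Projective (ShortComplex.mk a (pullback.fst p (cokernel.π i)) ha).X₃ := h₀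
  exact hE.of_retract a _ h₂.splittingOfProjective.f_r

end LeftDerived

/-! ### Vanishing of the first extension group -/

section ExtVanishing

universe w v'

open Abelian

variable {C : Type*} [Category.{v'} C] [Abelian C] [HasExt.{w} C]

/-- The objects `M` such that `Ext^1(X, M) = 0`. -/
def extVanishing (X : C) : ObjectProperty C := fun M ↦ Subsingleton (Ext X M 1)

variable {X : C}

namespace extVanishing

lemma exists_lift {A B M : C} {i : A ⟶ B} {p : B ⟶ M} {w : i ≫ p = 0}
    (h : (ShortComplex.mk i p w).ShortExact) (hA : extVanishing X A) (φ : X ⟶ M) :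
    ∃ ψ : X ⟶ B, ψ ≫ p = φ := by
  obtain ⟨x, hx⟩ := Ext.covariant_sequence_exact₃ X h (Ext.mk₀ φ) (zero_add 1) (hA.elim _ _)
  obtain ⟨ψ, rfl⟩ := Ext.addEquiv₀.symm.surjective x
  refine ⟨ψ, Ext.addEquiv₀.symm.injective ?_⟩
  simpa using hx

/-- In a short exact sequence `0 ⟶ A ⟶ B ⟶ M ⟶ 0` such that `Ext^1(X, B) = 0`, the vanishing of
`Ext^1(X, A)` follows from the surjectivity of `Hom(X, B) ⟶ Hom(X, M)`. -/
lemma of_exists_lift {A B M : C} {i : A ⟶ B} {p : B ⟶ M} {w : i ≫ p = 0}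
    (h : (ShortComplex.mk i p w).ShortExact) (hB : extVanishing X B)
    (H : ∀ φ : X ⟶ M, ∃ ψ : X ⟶ B, ψ ≫ p = φ) : extVanishing X A := by
  refine subsingleton_of_forall_eq 0 fun x ↦ ?_
  obtain ⟨y, rfl⟩ := Ext.covariant_sequence_exact₁ X h x (hB.elim _ _) (zero_add 1)
  obtain ⟨φ, rfl⟩ := Ext.addEquiv₀.symm.surjective y
  obtain ⟨ψ, rfl⟩ := H φ
  have := h.comp_extClass
  dsimp at this
  simp [← Ext.mk₀_comp_mk₀, Ext.comp_assoc_of_second_deg_zero, this]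

lemma of_shortExact {A B M : C} {i : A ⟶ B} {p : B ⟶ M} {w : i ≫ p = 0}
    (h : (ShortComplex.mk i p w).ShortExact) (hA : extVanishing X A) (hM : extVanishing X M) :
    extVanishing X B := by
  refine subsingleton_of_forall_eq 0 fun x ↦ ?_
  obtain ⟨y, rfl⟩ := Ext.covariant_sequence_exact₂ X h x (hM.elim _ _)
  rw [hA.elim y 0, Ext.zero_comp]

lemma of_injective (I : C) [Injective I] : extVanishing X I :=
  subsingleton_of_forall_eq 0 fun x ↦ Ext.eq_zero_of_injective x

instance : (extVanishing X).IsClosedUnderIsomorphisms where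
  of_iso e h := by
    refine subsingleton_of_forall_eq 0 fun x ↦ ?_
    have : (x.comp (Ext.mk₀ e.inv) (add_zero 1)).comp (Ext.mk₀ e.hom) (add_zero 1) = x := by
      simp
    rw [← this, h.elim (x.comp (Ext.mk₀ e.inv) (add_zero 1)) 0, Ext.zero_comp]

lemma biprod {M N : C} (hM : extVanishing X M) (hN : extVanishing X N) : extVanishing X (M ⊞ N) :=
  .of_shortExact (ShortComplex.Splitting.ofHasBinaryBiproduct M N).shortExact hM hN

/-- If `X` is of projective dimension at most `1`, then the functor `Ext^1(X, -)` is right exact,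
so that the class of objects at which it vanishes is closed under quotients. -/
lemma of_epi [HasProjectiveDimensionLE X 1] {B M : C} (p : B ⟶ M) [Epi p]
    (hB : extVanishing X B) : extVanishing X M := by
  have h : (ShortComplex.mk (kernel.ι p) p (kernel.condition _)).ShortExact :=
    ⟨ShortComplex.exact_kernel _⟩
  have : Subsingleton (Ext X (kernel p) 2) := HasProjectiveDimensionLT.subsingleton X 2 2 le_rfl _
  refine subsingleton_of_forall_eq 0 fun x ↦ ?_
  obtain ⟨y, rfl⟩ := Ext.covariant_sequence_exact₃ X h x (by simp : 1 + 1 = 2)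
    (Subsingleton.elim _ _)
  rw [hB.elim y 0, Ext.zero_comp]

end extVanishing

end ExtVanishing

/-! ### Functorial injective embeddings -/

section InjectiveEmbedding

open scoped ZeroObject

universe w

variable (C : Type*) [Category* C] [Abelian C] [IsGrothendieckAbelian.{w} C]

/-- The functor which sends an object `X` to the arrow `X ⟶ 0`. -/
@[simps]
def toZeroArrow : C ⥤ Arrow C where
  obj X := Arrow.mk (0 : X ⟶ 0)
  map φ := Arrow.homMk φ (𝟙 0) (by simp)

/-- A functor (not additive in general) with injective values in which the identity functor
embeds. -/
def functorialInjective : C ⥤ C :=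
  toZeroArrow C ⋙ (MorphismProperty.functorialFactorizationData
    (MorphismProperty.monomorphisms C) (MorphismProperty.monomorphisms C).rlp).Z

/-- The natural embedding of an object in an injective object. -/
def toFunctorialInjective : 𝟭 C ⟶ functorialInjective C where
  app X := (MorphismProperty.functorialFactorizationData (MorphismProperty.monomorphisms C)
    (MorphismProperty.monomorphisms C).rlp).i.app ((toZeroArrow C).obj X)
  naturality _ _ φ := (MorphismProperty.functorialFactorizationData
    (MorphismProperty.monomorphisms C) (MorphismProperty.monomorphisms C).rlp).i.naturality
      ((toZeroArrow C).map φ)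

instance (X : C) : Mono ((toFunctorialInjective C).app X) :=
  (MorphismProperty.functorialFactorizationData (MorphismProperty.monomorphisms C)
    (MorphismProperty.monomorphisms C).rlp).hi ((toZeroArrow C).obj X)

instance (X : C) : Injective ((functorialInjective C).obj X) :=
  inferInstanceAs
    (Injective (IsGrothendieckAbelian.monoMapFactorizationDataRlp (0 : X ⟶ 0)).Z)

end InjectiveEmbedding

/-! ### Coextension of scalars -/

section Coextension

variable {R U : Type u} [Ring R] [Ring U] (f : R →+* U)

/-- The elements of `Hom_R(U, M)`, as morphisms. -/
def coextendEquiv (M : ModuleCat.{u} R) :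
    (leftModule f ⟶ M) ≃ (ModuleCat.coextendScalars.{u, u, u} f).obj M where
  toFun φ := (ModuleCat.CoextendScalars.equiv f M).symm φ.hom
  invFun x := ConcreteCategory.ofHom (C := ModuleCat.{u} R) (X := leftModule f)
    (ModuleCat.CoextendScalars.equiv f M x)

lemma epi_coextendScalars_map_iff {M N : ModuleCat.{u} R} (g : M ⟶ N) :
    Epi ((ModuleCat.coextendScalars.{u, u, u} f).map g) ↔
      ∀ φ : leftModule f ⟶ N, ∃ ψ : leftModule f ⟶ M, ψ ≫ g = φ := by
  rw [ModuleCat.epi_iff_surjective]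
  constructor
  · intro h φ
    obtain ⟨x, hx⟩ := h (coextendEquiv f N φ)
    obtain ⟨ψ, rfl⟩ := (coextendEquiv f M).surjective x
    exact ⟨ψ, (coextendEquiv f N).injective hx⟩
  · intro h y
    obtain ⟨φ, rfl⟩ := (coextendEquiv f N).surjective y
    obtain ⟨ψ, rfl⟩ := h φ
    exact ⟨coextendEquiv f M ψ, rfl⟩

lemma isZero_coextendScalars_obj_iff (M : ModuleCat.{u} R) :
    IsZero ((ModuleCat.coextendScalars.{u, u, u} f).obj M) ↔ Subsingleton (leftModule f ⟶ M) := by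
  rw [ModuleCat.isZero_iff_subsingleton]
  exact (coextendEquiv f M).subsingleton_congr.symm

lemma isContramodule_iff (M : ModuleCat.{u} R) :
    IsContramodule f M ↔ IsZero ((ModuleCat.coextendScalars.{u, u, u} f).obj M) ∧
      extVanishing (leftModule f) M := by
  rw [isZero_coextendScalars_obj_iff]
  rfl

lemma extVanishing.epi_coextendScalars_map {A B M : ModuleCat.{u} R} {i : A ⟶ B} {p : B ⟶ M}
    {w : i ≫ p = 0} (h : (ShortComplex.mk i p w).ShortExact)
    (hA : extVanishing (leftModule f) A) : Epi ((ModuleCat.coextendScalars.{u, u, u} f).map p) := by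
  rw [epi_coextendScalars_map_iff]
  exact hA.exists_lift h

lemma mono_map_g_iff {C D : Type*} [Category* C] [Abelian C] [Category* D] [Abelian D] (G : C ⥤ D)
    [PreservesFiniteLimits G] [G.Additive] {X₁ X₂ X₃ : C} {i : X₁ ⟶ X₂} {p : X₂ ⟶ X₃}
    {w : i ≫ p = 0} (h : (ShortComplex.mk i p w).ShortExact) :
    Mono (G.map p) ↔ IsZero (G.obj X₁) := by
  have : Mono i := h.mono_f
  have h' : (ShortComplex.mk (G.map i) (G.map p) (by rw [← G.map_comp, w, G.map_zero])).Exact :=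
    h.exact.map_of_mono_of_preservesKernel G inferInstance inferInstance
  refine h'.mono_g_iff.trans ?_
  exact ⟨fun h ↦ (IsZero.iff_id_eq_zero _).2 (by
    rw [← cancel_mono (G.map i)]
    exact (Category.id_comp _).trans (h.trans zero_comp.symm)), fun h ↦ h.eq_of_src _ _⟩

variable [ProjDimLE f 1]

/-- The cohomology of `Hom_R(U, X)`, for a complex `X` with terms at which `Ext^1_R(U, -)`
vanishes. -/
lemma exactAt_coextendScalars_iff (X : CochainComplex (ModuleCat.{u} R) ℤ)
    (hX : ∀ n, extVanishing (leftModule f) (X.X n)) (n m : ℤ) (h : n + 1 = m) :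
    (((ModuleCat.coextendScalars.{u, u, u} f).mapHomologicalComplex (.up ℤ)).obj X).ExactAt m ↔
      extVanishing (leftModule f) (X.homology n) ∧
        IsZero ((ModuleCat.coextendScalars.{u, u, u} f).obj (X.homology m)) := by
  have h₁ (n : ℤ) : extVanishing (leftModule f) (coboundaries X n) :=
    (hX n).of_epi (X.pOpcycles n ≫ cokernel.π (X.homologyι n))
  have h₂ (n : ℤ) : Epi ((ModuleCat.coextendScalars.{u, u, u} f).map (X.pOpcycles n)) :=
    (h₁ (n - 1)).epi_coextendScalars_map f
      (shortExact_coboundaries_opcycles X (n - 1) n (by lia))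
  rw [exactAt_map_iff_of_epi_map X n m _ h]
  refine and_congr ⟨fun h₃ ↦ ?_, fun h₃ ↦ ?_⟩
    (mono_map_g_iff _ (shortExact_homology_coboundaries X m))
  · exact .of_exists_lift (shortExact_homology_coboundaries X n)
      ((hX n).of_epi (X.pOpcycles n)) ((epi_coextendScalars_map_iff f _).1 h₃)
  · exact h₃.epi_coextendScalars_map f (shortExact_homology_coboundaries X n)

lemma acyclic_coextendScalars_iff (X : CochainComplex (ModuleCat.{u} R) ℤ)
    (hX : ∀ n, extVanishing (leftModule f) (X.X n)) :
    (((ModuleCat.coextendScalars.{u, u, u} f).mapHomologicalComplex (.up ℤ)).obj X).Acyclic ↔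
      ∀ n, IsContramodule f (X.homology n) := by
  simp only [isContramodule_iff]
  constructor
  · intro h n
    exact ⟨((exactAt_coextendScalars_iff f X hX (n - 1) n (by lia)).1 (h n)).2,
      ((exactAt_coextendScalars_iff f X hX n (n + 1) rfl).1 (h (n + 1))).1⟩
  · intro h n
    exact (exactAt_coextendScalars_iff f X hX (n - 1) n (by lia)).2 ⟨(h _).2, (h _).1⟩

lemma quasiIso_coextendScalars_map {X Y : CochainComplex (ModuleCat.{u} R) ℤ} (φ : X ⟶ Y)
    (hX : ∀ n, extVanishing (leftModule f) (X.X n))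
    (hY : ∀ n, extVanishing (leftModule f) (Y.X n)) (hφ : QuasiIso φ) :
    QuasiIso (((ModuleCat.coextendScalars.{u, u, u} f).mapHomologicalComplex (.up ℤ)).map φ) := by
  refine quasiIso_map_of_acyclic_map _ (extVanishing (leftModule f)) (fun _ _ hM hN ↦ hM.biprod hN)
    (fun X hX h ↦ ?_) φ hX hY hφ
  rw [acyclic_coextendScalars_iff f X hX]
  intro n
  rw [isContramodule_iff]
  have := (h n).isZero_homology
  have : Injective (X.homology n) := ⟨fun _ _ _ ↦ ⟨0, this.eq_of_tgt _ _⟩⟩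
  exact ⟨Functor.map_isZero _ ‹IsZero _›, .of_injective _⟩

lemma extVanishing_rightRes (X : CochainComplex (ModuleCat.{u} R) ℤ) (n : ℤ) :
    extVanishing (leftModule f) ((rightRes (toFunctorialInjective (ModuleCat.{u} R)) X).X n) := by
  let η := toFunctorialInjective (ModuleCat.{u} R)
  have : Epi (biprod.desc (rightRes.inl η X n) (rightRes.inr η X n)) :=
    (rightRes.isPushout η X n).epi_shortComplex_g
  exact .of_epi (biprod.desc (rightRes.inl η X n) (rightRes.inr η X n)) (extVanishing.biprod
    (.of_injective ((functorialInjective _).obj (X.X (n - 1))))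
    (.of_injective ((functorialInjective _).obj (X.X n))))

end Coextension

/-! ### Extension of scalars -/

section Extension

variable {R U : Type u} [Ring R] [Ring U] (f : R →+* U)

/-- The element `x ⊗ m` of `U ⊗_R M`. -/
def extendTmul {M : ModuleCat.{u} R} (x : U) (m : M) : (extendScalars f).obj M :=
  (Submodule.Quotient.mk (x ⊗ₜ[ℤ] m) : ExtendedModule f M)

section

variable {M : ModuleCat.{u} R}

lemma smul_extendTmul (y x : U) (m : M) : y • extendTmul f x m = extendTmul f (y * x) m := rfl

lemma extendTmul_add (x : U) (m m' : M) :
    extendTmul f x (m + m') = extendTmul f x m + extendTmul f x m' := by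
  rw [extendTmul, TensorProduct.tmul_add]
  rfl

lemma extendTmul_smul (x : U) (r : R) (m : M) :
    extendTmul f x (r • m) = extendTmul f (x * f r) m := by
  refine ((Submodule.Quotient.eq (balancingRelations f M)).2 ?_).symm
  exact Submodule.subset_span ⟨x, r, m, rfl⟩

lemma extendScalars_map_extendTmul {N : ModuleCat.{u} R} (g : M ⟶ N) (x : U) (m : M) :
    ((extendScalars f).map g).hom (extendTmul f x m) = extendTmul f x (g.hom m) := rfl

lemma extendTmul_induction {p : (extendScalars f).obj M → Prop} (h₀ : p 0)
    (h₁ : ∀ x m, p (extendTmul f x m)) (h₂ : ∀ s t, p s → p t → p (s + t))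
    (t : (extendScalars f).obj M) : p t := by
  obtain ⟨t, rfl⟩ := Submodule.Quotient.mk_surjective _ t
  induction t using TensorProduct.induction_on with
  | zero => exact h₀
  | tmul x m => exact h₁ x m
  | add a b ha hb => exact h₂ _ _ ha hb

lemma extendScalars_hom_ext {N : ModuleCat.{u} U} {g h : (extendScalars f).obj M ⟶ N}
    (H : ∀ m, g.hom (extendTmul f 1 m) = h.hom (extendTmul f 1 m)) : g = h := by
  ext1
  refine extendedModule_hom_ext f fun x m ↦ ?_
  have h₁ : extendTmul f x m = x • extendTmul f 1 m := by rw [smul_extendTmul, mul_one]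
  change g.hom (extendTmul f x m) = h.hom (extendTmul f x m)
  rw [h₁, map_smul, map_smul, H]

/-- The `U`-linear map `U ⊗_R M ⟶ N` corresponding to an `R`-linear map `M ⟶ N`. -/
def extendScalarsDesc {N : ModuleCat.{u} U} (h : M ⟶ (ModuleCat.restrictScalars.{u} f).obj N) :
    (extendScalars f).obj M ⟶ N :=
  ModuleCat.ofHom (Submodule.liftQ _
    (TensorProduct.AlgebraTensorModule.lift
      { toFun x :=
          { toFun m := x • (show N from h.hom m)
            map_add' m m' := by
              rw [map_add]
              exact smul_add x (show N from h.hom m) (show N from h.hom m')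
            map_smul' n m := by
              rw [map_zsmul]
              exact smul_comm x n (show N from h.hom m) }
        map_add' x x' := LinearMap.ext fun m ↦ add_smul x x' (show N from h.hom m)
        map_smul' z x := LinearMap.ext fun m ↦ mul_smul z x (show N from h.hom m) } :
      U ⊗[ℤ] M →ₗ[U] N)
    (by
      rw [balancingRelations, Submodule.span_le]
      rintro _ ⟨x, r, m, rfl⟩
      rw [SetLike.mem_coe, LinearMap.mem_ker, map_sub, sub_eq_zero]
      change (x * f r) • (show N from h.hom m) = x • (show N from h.hom (r • m))
      rw [map_smul, mul_smul]
      rfl))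

end

/-- Extension of scalars is left adjoint to the restriction of scalars. -/
def extendRestrictAdj : extendScalars f ⊣ ModuleCat.restrictScalars.{u} f :=
  Adjunction.mkOfHomEquiv
    { homEquiv M N :=
        { toFun g := ModuleCat.ofHom (Y := (ModuleCat.restrictScalars.{u} f).obj N)
            { toFun m := (g.hom (extendTmul f 1 m) : N)
              map_add' m m' := by
                rw [extendTmul_add, map_add]
                rfl
              map_smul' r m := by
                have h : extendTmul f (1 * f r) m = f r • extendTmul f 1 m := by
                  rw [smul_extendTmul, one_mul, mul_one]
                rw [extendTmul_smul, h, map_smul]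
                rfl }
          invFun h := extendScalarsDesc f h
          left_inv g := extendScalars_hom_ext f fun m ↦
            one_smul U (g.hom (extendTmul f 1 m))
          right_inv h := by
            ext m
            exact one_smul U (show N from h.hom m) }
      homEquiv_naturality_left_symm _ _ := extendScalars_hom_ext f fun _ ↦ rfl
      homEquiv_naturality_right _ _ := rfl }

instance : PreservesColimitsOfSize.{u, u} (extendScalars f) :=
  (extendRestrictAdj f).leftAdjoint_preservesColimits

instance : PreservesFiniteColimits (extendScalars f) :=
  PreservesColimitsOfSize.preservesFiniteColimits _

instance : PreservesColimitsOfSize.{u, u} (ModuleCat.restrictScalars.{u} f) :=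
  (ModuleCat.restrictCoextendScalarsAdj.{u, u, u} f).leftAdjoint_preservesColimits

lemma isComodule_iff (M : ModuleCat.{u} R) :
    IsComodule f M ↔ IsZero ((extendScalars f).obj M) ∧ PreservesMonosOver (extendScalars f) M := by
  rw [preservesMonosOver_iff_isZero_leftDerived]
  rfl

lemma epi_map_f_iff {C D : Type*} [Category* C] [Abelian C] [Category* D] [Abelian D] (G : C ⥤ D)
    [PreservesFiniteColimits G] [G.Additive] {X₁ X₂ X₃ : C} {i : X₁ ⟶ X₂} {p : X₂ ⟶ X₃}
    {w : i ≫ p = 0} (h : (ShortComplex.mk i p w).ShortExact) :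
    Epi (G.map i) ↔ IsZero (G.obj X₃) := by
  have : Epi p := h.epi_g
  have h' : (ShortComplex.mk (G.map i) (G.map p) (by rw [← G.map_comp, w, G.map_zero])).Exact :=
    h.exact.map_of_epi_of_preservesCokernel G inferInstance inferInstance
  refine h'.epi_f_iff.trans ?_
  exact ⟨fun h ↦ (IsZero.iff_id_eq_zero _).2 (by
    rw [← cancel_epi (G.map p)]
    exact (Category.comp_id _).trans (h.trans comp_zero.symm)), fun h ↦ h.eq_of_tgt _ _⟩

lemma FlatDimLE.preservesMonosOver_of_mono {f : R →+* U} (hf : FlatDimLE f 1)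
    {A B : ModuleCat.{u} R} (i : A ⟶ B) [Mono i] (hB : PreservesMonosOver (extendScalars f) B) :
    PreservesMonosOver (extendScalars f) A :=
  .of_mono (fun M ↦ hf M 2 one_lt_two) i hB

/-- The cohomology of `U ⊗_R X`, for a complex `X` with terms at which `Tor_1^R(U, -)`
vanishes. -/
lemma exactAt_extendScalars_iff (hf : FlatDimLE f 1) (X : CochainComplex (ModuleCat.{u} R) ℤ)
    (hX : ∀ n, PreservesMonosOver (extendScalars f) (X.X n)) (n m : ℤ) (h : n + 1 = m) :
    (((extendScalars f).mapHomologicalComplex (.up ℤ)).obj X).ExactAt n ↔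
      IsZero ((extendScalars f).obj (X.homology n)) ∧
        PreservesMonosOver (extendScalars f) (X.homology m) := by
  have h₁ (n : ℤ) : Mono ((extendScalars f).map (X.iCycles n)) :=
    hf.preservesMonosOver_of_mono (kernel.ι (X.homologyπ (n + 1)) ≫ X.iCycles (n + 1)) (hX _) _ _ _
      (shortExact_cycles_boundaries X n (n + 1) rfl)
  rw [exactAt_map_iff_of_mono_map X n m _ h]
  refine and_congr (epi_map_f_iff _ (shortExact_boundaries_homology X n)) ⟨fun h₃ ↦ ?_, fun h₃ ↦ ?_⟩
  · exact .of_shortExact_right (shortExact_boundaries_homology X m)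
      (hf.preservesMonosOver_of_mono (X.iCycles m) (hX m)) h₃
  · exact h₃ _ _ _ (shortExact_boundaries_homology X m)

lemma acyclic_extendScalars_iff (hf : FlatDimLE f 1) (X : CochainComplex (ModuleCat.{u} R) ℤ)
    (hX : ∀ n, PreservesMonosOver (extendScalars f) (X.X n)) :
    (((extendScalars f).mapHomologicalComplex (.up ℤ)).obj X).Acyclic ↔
      ∀ n, IsComodule f (X.homology n) := by
  simp only [isComodule_iff]
  constructor
  · intro h n
    obtain ⟨m, rfl⟩ : ∃ m, n = m + 1 := ⟨n - 1, by lia⟩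
    exact ⟨((exactAt_extendScalars_iff f hf X hX _ _ rfl).1 (h (m + 1))).1,
      ((exactAt_extendScalars_iff f hf X hX m _ rfl).1 (h m)).2⟩
  · intro h n
    exact (exactAt_extendScalars_iff f hf X hX n _ rfl).2 ⟨(h _).1, (h _).2⟩

lemma quasiIso_extendScalars_map (hf : FlatDimLE f 1) {X Y : CochainComplex (ModuleCat.{u} R) ℤ}
    (φ : X ⟶ Y) (hX : ∀ n, PreservesMonosOver (extendScalars f) (X.X n))
    (hY : ∀ n, PreservesMonosOver (extendScalars f) (Y.X n)) (hφ : QuasiIso φ) :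
    QuasiIso (((extendScalars f).mapHomologicalComplex (.up ℤ)).map φ) := by
  refine quasiIso_map_of_acyclic_map _ (PreservesMonosOver (extendScalars f))
    (fun _ _ hM hN ↦ hM.biprod hN) (fun X hX h ↦ ?_) φ hX hY hφ
  rw [acyclic_extendScalars_iff f hf X hX]
  intro n
  rw [isComodule_iff]
  have := (h n).isZero_homology
  have : Projective (X.homology n) := ⟨fun _ _ _ ↦ ⟨0, this.eq_of_src _ _⟩⟩
  exact ⟨Functor.map_isZero _ ‹IsZero _›, .of_projective _⟩

instance (M : ModuleCat.{u} R) :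
    Projective ((forget (ModuleCat.{u} R) ⋙ ModuleCat.free.{u} R).obj M) :=
  ModuleCat.projective_of_free (Finsupp.basisSingleOne (R := R) (ι := M))

lemma preservesMonosOver_leftRes (hf : FlatDimLE f 1) (X : CochainComplex (ModuleCat.{u} R) ℤ)
    (n : ℤ) : PreservesMonosOver (extendScalars f)
      ((leftRes (ModuleCat.adj.{u} R).counit X).X n) := by
  let ε := (ModuleCat.adj.{u} R).counit
  have : Mono (biprod.lift (leftRes.fst ε X n) (leftRes.snd ε X n)) := ⟨fun g h H ↦
    leftRes.hom_ext ε (by simpa using H =≫ biprod.fst) (by simpa using H =≫ biprod.snd)⟩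
  exact hf.preservesMonosOver_of_mono (biprod.lift (leftRes.fst ε X n) (leftRes.snd ε X n))
    (.biprod (.of_projective _) (.of_projective _))

end Extension

/-! ### Copowers -/

section Copower

variable {C D : Type*} [Category* C] [Category* D] (ι : Type u)

/-- The functor which sends an object `M` to the coproduct of copies of `M` indexed by `ι`. -/
def copower (C : Type*) [Category* C] [HasColimitsOfShape (Discrete ι) C] : C ⥤ C :=
  Functor.const (Discrete ι) ⋙ colim

variable [HasColimitsOfShape (Discrete ι) C] [HasColimitsOfShape (Discrete ι) D]

/-- A functor which preserves coproducts commutes with copowers. -/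
def copowerIso (F : C ⥤ D) [PreservesColimitsOfShape (Discrete ι) F] :
    copower ι C ⋙ F ≅ F ⋙ copower ι D :=
  Functor.associator _ _ _ ≪≫ Functor.isoWhiskerLeft _ (preservesColimitNatIso F) ≪≫
    (Functor.associator _ _ _).symm ≪≫
      Functor.isoWhiskerRight (Functor.compConstIso (Discrete ι) F).symm _ ≪≫
        Functor.associator _ _ _

/-- The inclusion of a copy of `M` in a copower. -/
def copowerι (M : C) (i : ι) : M ⟶ (copower ι C).obj M :=
  colimit.ι ((Functor.const (Discrete ι)).obj M) ⟨i⟩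

/-- The morphism from a copower with the given components. -/
def copowerDesc {M N : C} (φ : ι → (M ⟶ N)) : (copower ι C).obj M ⟶ N :=
  colimit.desc ((Functor.const (Discrete ι)).obj M)
    ⟨N, Discrete.natTrans fun i ↦ φ i.as⟩

lemma copowerι_desc {M N : C} (φ : ι → (M ⟶ N)) (i : ι) :
    copowerι ι M i ≫ copowerDesc ι φ = φ i :=
  colimit.ι_desc _ _

instance (P : C) [Projective P] : Projective ((copower ι C).obj P) where
  factors φ e _ := ⟨copowerDesc ι fun i ↦ Projective.factorThru (copowerι ι P i ≫ φ) e,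
    colimit.hom_ext fun ⟨i⟩ ↦ by
      change copowerι ι P i ≫ _ = copowerι ι P i ≫ _
      rw [← Category.assoc, copowerι_desc, Projective.factorThru_comp]⟩

variable {ι} in
lemma PreservesMonosOver.copower {C D : Type*} [Category* C] [Abelian C] [EnoughProjectives C]
    [Category* D] [Abelian D] [HasColimitsOfShape (Discrete ι) C]
    [HasColimitsOfShape (Discrete ι) D] [HasExactColimitsOfShape (Discrete ι) C]
    [HasExactColimitsOfShape (Discrete ι) D] {F : C ⥤ D} [PreservesFiniteColimits F]
    [PreservesColimitsOfShape (Discrete ι) F] {M : C} (hM : PreservesMonosOver F M) :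
    PreservesMonosOver F ((copower ι C).obj M) := by
  have h : (ShortComplex.mk (kernel.ι (Projective.π M)) (Projective.π M)
      (kernel.condition _)).ShortExact := ⟨ShortComplex.exact_kernel _⟩
  have : PreservesFiniteLimits (RingEpi.copower ι C) := comp_preservesFiniteLimits _ _
  have : PreservesFiniteLimits (RingEpi.copower ι D) := comp_preservesFiniteLimits _ _
  have : PreservesFiniteColimits (RingEpi.copower ι C) := comp_preservesFiniteColimits _ _
  have : (RingEpi.copower ι C).Additive := Functor.additive_of_preserves_binary_products _
  refine .of_projective_presentation (h.map_of_exact (RingEpi.copower ι C)) ?_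
  have := hM _ _ _ h
  have h' := (copowerIso ι F).hom.naturality (kernel.ι (Projective.π M))
  dsimp at h' ⊢
  have : Mono (F.map ((RingEpi.copower ι C).map (kernel.ι (Projective.π M))) ≫
      (copowerIso ι F).hom.app _) := by
    rw [h']
    infer_instance
  exact mono_of_mono _ ((copowerIso ι F).hom.app _)

end Copower

/-! ### Homological epimorphisms -/

section HomologicalEpi

variable {R U : Type u} [Ring R] [Ring U] {f : R →+* U} (hf : IsHomologicalEpi f)

include hf

/-- In `U ⊗_R N`, for a `U`-module `N`, the tensors are balanced over `U`. -/
lemma IsHomologicalEpi.extendTmul_eq {N : ModuleCat.{u} U} (x : U) (n : N) :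
    extendTmul (M := (ModuleCat.restrictScalars.{u} f).obj N) f x n =
      extendTmul (M := (ModuleCat.restrictScalars.{u} f).obj N) f 1
        (show (ModuleCat.restrictScalars.{u} f).obj N from x • n) := by
  have h : extendTmul (M := leftModule f) f x (show leftModule f from (1 : U)) =
      extendTmul (M := leftModule f) f 1 (show leftModule f from x) :=
    hf.bijective_mulMap.1 (by
      change x * 1 = 1 * x
      rw [mul_one, one_mul])
  -- this equality is mapped to the desired one by the map induced by `U ⟶ N`, `y ↦ y • n`
  let g : ModuleCat.of U U ⟶ N := ModuleCat.ofHom (LinearMap.toSpanSingleton U N n)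
  have h' := congr(((extendScalars f).map ((ModuleCat.restrictScalars.{u} f).map g)).hom $h)
  rw [extendScalars_map_extendTmul, extendScalars_map_extendTmul] at h'
  have h₁ : g.hom (1 : U) = n := one_smul U n
  change extendTmul f x (show (ModuleCat.restrictScalars.{u} f).obj N from g.hom (1 : U)) = _ at h'
  rw [h₁] at h'
  exact h'

lemma IsHomologicalEpi.isIso_counit_app (N : ModuleCat.{u} U) :
    IsIso ((extendRestrictAdj f).counit.app N) := by
  have h (t : (extendScalars f).obj ((ModuleCat.restrictScalars.{u} f).obj N)) :
      ∃ n : (ModuleCat.restrictScalars.{u} f).obj N, t = extendTmul f 1 n := by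
    induction t using extendTmul_induction with
    | h₀ => exact ⟨0, by
        have := extendTmul_add f (M := (ModuleCat.restrictScalars.{u} f).obj N) 1 0 0
        rw [add_zero] at this
        exact (left_eq_add.1 this).symm⟩
    | h₁ x n => exact ⟨_, hf.extendTmul_eq x n⟩
    | h₂ s t hs ht =>
      obtain ⟨a, rfl⟩ := hs
      obtain ⟨b, rfl⟩ := ht
      exact ⟨a + b, (extendTmul_add f _ _ _).symm⟩
  refine (ConcreteCategory.isIso_iff_bijective _).2 ⟨fun s t hst ↦ ?_, fun n ↦ ?_⟩
  · obtain ⟨a, rfl⟩ := h s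
    obtain ⟨b, rfl⟩ := h t
    have hab : (1 : U) • (show N from a) = (1 : U) • (show N from b) := hst
    rw [one_smul, one_smul] at hab
    exact congr(extendTmul f 1 $hab)
  · exact ⟨extendTmul (M := (ModuleCat.restrictScalars.{u} f).obj N) f 1 n, one_smul U n⟩

lemma IsHomologicalEpi.isIso_unit_app (N : ModuleCat.{u} U) :
    IsIso ((ModuleCat.restrictCoextendScalarsAdj.{u, u, u} f).unit.app N) := by
  have := hf.isIso_counit_app
  have : IsIso (extendRestrictAdj f).counit := NatIso.isIso_of_isIso_app _
  have := (extendRestrictAdj f).fullyFaithfulROfIsIsoCounit.full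
  have := (extendRestrictAdj f).fullyFaithfulROfIsIsoCounit.faithful
  infer_instance

lemma IsHomologicalEpi.preservesMonosOver_leftModule :
    PreservesMonosOver (extendScalars f) (leftModule f) :=
  (preservesMonosOver_iff_isZero_leftDerived _).2 (hf.isZero_tor 1 one_pos)

/-- `Tor_1^R(U, N) = 0` for any `U`-module `N`. -/
lemma IsHomologicalEpi.preservesMonosOver_restrictScalars (N : ModuleCat.{u} U) :
    PreservesMonosOver (extendScalars f) ((ModuleCat.restrictScalars.{u} f).obj N) := by
  -- the functor `Tor_1^R(U, -)` vanishes at `U`, hence at the free module `P` with basis `N`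
  let P := (copower N (ModuleCat.{u} U)).obj (ModuleCat.of U U)
  have hP : PreservesMonosOver (extendScalars f) ((ModuleCat.restrictScalars.{u} f).obj P) :=
    (PreservesMonosOver (extendScalars f)).prop_of_iso
      ((copowerIso N (ModuleCat.restrictScalars.{u} f)).app (ModuleCat.of U U)).symm
      hf.preservesMonosOver_leftModule.copower
  let p : P ⟶ N := copowerDesc N fun n ↦ ModuleCat.ofHom (LinearMap.toSpanSingleton U N n)
  have : Epi p := by
    rw [ModuleCat.epi_iff_surjective]
    intro n
    refine ⟨(copowerι N (ModuleCat.of U U) n).hom (1 : U), ?_⟩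
    have := congr(($(copowerι_desc N (fun n : N ↦ ModuleCat.ofHom
      (LinearMap.toSpanSingleton U N n)) n)).hom (1 : U))
    exact this.trans (one_smul U n)
  have h : (ShortComplex.mk (kernel.ι p) p (kernel.condition _)).ShortExact :=
    ⟨ShortComplex.exact_kernel _⟩
  refine .of_shortExact_right (h.map_of_exact (ModuleCat.restrictScalars.{u} f)) hP ?_
  -- `U ⊗_R -` preserves the monomorphisms of `U`-modules, since the counit is an isomorphism
  have := hf.isIso_counit_app
  let i : kernel p ⟶ P := kernel.ι p
  have hi : Mono i := inferInstance
  have h' : (extendScalars f).map ((ModuleCat.restrictScalars.{u} f).map i) ≫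
      (extendRestrictAdj f).counit.app P = (extendRestrictAdj f).counit.app (kernel p) ≫ i :=
    (extendRestrictAdj f).counit.naturality i
  have hc : Mono ((extendRestrictAdj f).counit.app (kernel p)) :=
    @IsIso.mono_of_iso _ _ _ _ _ (hf.isIso_counit_app (kernel p))
  have := @mono_comp _ _ _ _ _ ((extendRestrictAdj f).counit.app (kernel p)) hc i hi
  exact mono_of_mono_fac h'

/-- `Ext^1_R(U, N) = 0` for any `U`-module `N`. -/
lemma IsHomologicalEpi.extVanishing_restrictScalars (N : ModuleCat.{u} U) :
    extVanishing (leftModule f) ((ModuleCat.restrictScalars.{u} f).obj N) := by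
  let p := Projective.π (leftModule f)
  have h : (ShortComplex.mk (kernel.ι p) p (kernel.condition _)).ShortExact :=
    ⟨ShortComplex.exact_kernel _⟩
  -- the sequence obtained by extension of scalars splits, since `U ⊗_R U ≅ U` is projective
  have hm : Mono ((extendScalars f).map (kernel.ι p)) := hf.preservesMonosOver_leftModule _ _ _ h
  have h' : (ShortComplex.mk ((extendScalars f).map (kernel.ι p)) ((extendScalars f).map p)
      (by rw [← Functor.map_comp, kernel.condition, Functor.map_zero])).ShortExact :=
    ⟨h.exact.map_of_epi_of_preservesCokernel _ inferInstance inferInstance⟩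
  have := hf.isIso_counit_app (ModuleCat.of U U)
  have : Projective ((extendScalars f).obj (leftModule f)) :=
    Projective.of_iso (asIso ((extendRestrictAdj f).counit.app (ModuleCat.of U U))).symm
      (ModuleCat.projective_of_categoryTheory_projective _)
  let s := h'.splittingOfProjective
  refine subsingleton_of_forall_eq 0 fun x ↦ ?_
  obtain ⟨y, rfl⟩ := Abelian.Ext.contravariant_sequence_exact₃ h _ x
    (Abelian.Ext.eq_zero_of_projective _) (add_zero 1)
  obtain ⟨φ, rfl⟩ := Abelian.Ext.addEquiv₀.symm.surjective y
  -- hence `φ : K ⟶ N` extends to the projective cover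
  let adj := extendRestrictAdj f
  let ψ := adj.homEquiv _ _ (s.r ≫ (adj.homEquiv _ _).symm φ)
  have hψ : kernel.ι p ≫ ψ = φ := by
    rw [← adj.homEquiv_naturality_left]
    have := s.f_r
    dsimp at this
    rw [reassoc_of% this]
    simp
  have h₀ := h.extClass_comp
  dsimp at h₀
  rw [← hψ]
  simp [← Abelian.Ext.mk₀_comp_mk₀, ← Abelian.Ext.comp_assoc_of_second_deg_zero, h₀]

end HomologicalEpi

/-! ### The derived functors of extension and coextension of scalars -/

section Derived

section

variable {A : Type*} [Category* A] [Abelian A] [HasDerivedCategory.{w₁} A]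

lemma isZero_homologyFunctor_obj_Q_iff (K : CochainComplex A ℤ) (n : ℤ) :
    IsZero ((DerivedCategory.homologyFunctor A n).obj (DerivedCategory.Q.obj K)) ↔ K.ExactAt n :=
  ((DerivedCategory.homologyFunctorFactors A n).app K).isZero_iff.trans
    (HomologicalComplex.exactAt_iff_isZero_homology K n).symm

lemma isZero_iff_isZero_homology (X : DerivedCategory A) :
    IsZero X ↔ ∀ n : ℤ, IsZero ((DerivedCategory.homologyFunctor A n).obj X) := by
  refine ⟨fun h n ↦ Functor.map_isZero _ h, fun h ↦ ?_⟩
  have : X.IsLE 0 := (DerivedCategory.isLE_iff X 0).2 fun i _ ↦ h i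
  have : X.IsGE 1 := (DerivedCategory.isGE_iff X 1).2 fun i _ ↦ h i
  exact DerivedCategory.TStructure.t.isZero X 0 1 (by lia)

end

variable {R U : Type u} [Ring R] [Ring U] {f : R →+* U}
  [HasDerivedCategory.{w₁} (ModuleCat.{u} R)] [HasDerivedCategory.{w₂} (ModuleCat.{u} U)]

lemma preservesDStar_of_isGE_of_isLE
    (F : DerivedCategory (ModuleCat.{u} R) ⥤ DerivedCategory (ModuleCat.{u} U)) (a b : ℤ)
    (ha : ∀ X (n : ℤ), X.IsGE n → (F.obj X).IsGE (n + a))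
    (hb : ∀ X (n : ℤ), X.IsLE n → (F.obj X).IsLE (n + b)) (s : DSymbol) : PreservesDStar F s := by
  have hplus (X : DerivedCategory (ModuleCat.{u} R)) (h : DerivedCategory.TStructure.t.plus X) :
      DerivedCategory.TStructure.t.plus (F.obj X) := by
    obtain ⟨n, hn⟩ := h
    exact ⟨n + a, ha X n hn⟩
  have hminus (X : DerivedCategory (ModuleCat.{u} R)) (h : DerivedCategory.TStructure.t.minus X) :
      DerivedCategory.TStructure.t.minus (F.obj X) := by
    obtain ⟨n, hn⟩ := h
    exact ⟨n + b, hb X n hn⟩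
  intro X hX
  cases s with
  | bounded => exact ⟨hplus X hX.1, hminus X hX.2⟩
  | plus => exact hplus X hX
  | minus => exact hminus X hX
  | unbounded => trivial

lemma isZero_iff_isZero_obj {s : DSymbol} (X : DCat (ModuleCat.{u} R) s) :
    IsZero X ↔ IsZero X.obj :=
  ⟨fun h ↦ Functor.map_isZero (s.prop _).ι h,
    fun h ↦ IsZero.of_full_of_faithful_of_isZero (s.prop _).ι _ h⟩

lemma kernel_inducedDStar
    {F : DerivedCategory (ModuleCat.{u} R) ⥤ DerivedCategory (ModuleCat.{u} U)}
    {P : ObjectProperty (ModuleCat.{u} R)}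
    (hF : ∀ X, IsZero (F.obj X) ↔ ∀ n : ℤ, P ((DerivedCategory.homologyFunctor _ n).obj X))
    (s : DSymbol) (h : PreservesDStar F s) :
    (inducedDStar F s h).kernel =
      fun X ↦ ∀ n : ℤ, P ((DerivedCategory.homologyFunctor _ n).obj X.obj) := by
  ext X
  exact (isZero_iff_isZero_obj ((inducedDStar F s h).obj X)).trans (hF X.obj)

section Left

variable (hf : FlatDimLE f 1)
include hf

lemma FlatDimLE.hasLExtend : HasLExtend f :=
  (hasLeftDerivedFunctor_of_resolution (extendScalars f)
    (leftResNatTrans (ModuleCat.adj.{u} R).counit) (fun _ ↦ quasiIso_leftResπ _ _)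
    (fun X ↦ ∀ n, PreservesMonosOver (extendScalars f) (X.X n))
    (fun X n ↦ preservesMonosOver_leftRes f hf X n)
    (fun _ _ φ hX hY hφ ↦ quasiIso_extendScalars_map f hf φ hX hY hφ)).1

variable [HasLExtend f]

/-- The derived functor `L u^*` is computed by the complexes whose terms have vanishing
`Tor_1^R(U, -)`, and it is left adjoint to `u_*`. For a homological epimorphism, the complexes of
`U`-modules have this property over `R`, so that the counit is an isomorphism. -/
lemma FlatDimLE.lExtend_adjunction :
    (∀ X : CochainComplex (ModuleCat.{u} R) ℤ,
      (∀ n, PreservesMonosOver (extendScalars f) (X.X n)) →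
      Nonempty ((lExtend f).obj (DerivedCategory.Q.obj X) ≅
        DerivedCategory.Q.obj (((extendScalars f).mapHomologicalComplex (.up ℤ)).obj X))) ∧
    ∃ adj : lExtend f ⊣ restrictD f, IsHomologicalEpi f → IsIso adj.counit := by
  have : (lExtend f).IsLeftDerivedFunctor
      ((extendK f).totalLeftDerivedCounit DerivedCategory.Qh (HomotopyCategory.quasiIso _ (.up ℤ)))
      (HomotopyCategory.quasiIso _ (.up ℤ)) := by
    dsimp only [lExtend]
    infer_instance
  obtain ⟨h, adj, hadj⟩ := leftDerived_adjunction
    (leftResNatTrans (ModuleCat.adj.{u} R).counit) (fun _ ↦ quasiIso_leftResπ _ _)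
    (fun X ↦ ∀ n, PreservesMonosOver (extendScalars f) (X.X n))
    (fun X n ↦ preservesMonosOver_leftRes f hf X n)
    (fun _ _ φ hX hY hφ ↦ quasiIso_extendScalars_map f hf φ hX hY hφ) (extendRestrictAdj f)
    (lExtend f)
    ((extendK f).totalLeftDerivedCounit DerivedCategory.Qh (HomotopyCategory.quasiIso _ (.up ℤ)))
  exact ⟨h, adj, fun H ↦ hadj H.isIso_counit_app
    fun Y n ↦ H.preservesMonosOver_restrictScalars (Y.X n)⟩

/-- The module `H^n(L u^* X)` is an extension of `Tor_1^R(U, H^{n+1}(X))` by `U ⊗_R H^n(X)`, so that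
it vanishes if and only if these two modules vanish. -/
lemma FlatDimLE.isZero_homology_lExtend_iff (X : DerivedCategory (ModuleCat.{u} R)) (n m : ℤ)
    (h : n + 1 = m) :
    IsZero ((DerivedCategory.homologyFunctor _ n).obj ((lExtend f).obj X)) ↔
      IsZero ((extendScalars f).obj ((DerivedCategory.homologyFunctor _ n).obj X)) ∧
        PreservesMonosOver (extendScalars f) ((DerivedCategory.homologyFunctor _ m).obj X) := by
  let Y := DerivedCategory.Q.objPreimage X
  let K := leftRes (ModuleCat.adj.{u} R).counit Y
  let e : X ≅ DerivedCategory.Q.obj K := (DerivedCategory.Q.objObjPreimageIso X).symm ≪≫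
    (asIso (DerivedCategory.Q.map (leftRes.π (ModuleCat.adj.{u} R).counit Y))).symm
  have hK := preservesMonosOver_leftRes f hf Y
  obtain ⟨e'⟩ := hf.lExtend_adjunction.1 K hK
  have e'' (n : ℤ) : (DerivedCategory.homologyFunctor _ n).obj X ≅ K.homology n :=
    (DerivedCategory.homologyFunctor _ n).mapIso e ≪≫
      (DerivedCategory.homologyFunctorFactors _ n).app K
  rw [((DerivedCategory.homologyFunctor _ n).mapIso ((lExtend f).mapIso e ≪≫ e')).isZero_iff,
    isZero_homologyFunctor_obj_Q_iff, exactAt_extendScalars_iff f hf K hK n m h,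
    ((extendScalars f).mapIso (e'' n)).isZero_iff,
    (PreservesMonosOver (extendScalars f)).prop_iff_of_iso (e'' m)]

lemma FlatDimLE.isZero_lExtend_obj_iff (X : DerivedCategory (ModuleCat.{u} R)) :
    IsZero ((lExtend f).obj X) ↔
      ∀ n : ℤ, IsComodule f ((DerivedCategory.homologyFunctor _ n).obj X) := by
  simp only [isZero_iff_isZero_homology, isComodule_iff,
    hf.isZero_homology_lExtend_iff X _ _ rfl, forall_and]
  refine and_congr_right fun _ ↦ ⟨fun h n ↦ ?_, fun h n ↦ h _⟩
  obtain ⟨m, rfl⟩ : ∃ m, n = m + 1 := ⟨n - 1, by lia⟩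
  exact h m

lemma FlatDimLE.preservesDStar_lExtend (s : DSymbol) : PreservesDStar (lExtend f) s := by
  have h₀ {M : ModuleCat.{u} R} (hM : IsZero M) : PreservesMonosOver (extendScalars f) M := by
    have : Projective M := ⟨fun _ _ _ ↦ ⟨0, hM.eq_of_src _ _⟩⟩
    exact .of_projective _
  refine preservesDStar_of_isGE_of_isLE _ (-1) 0 (fun X n hX ↦ ?_) (fun X n hX ↦ ?_) s
  · rw [DerivedCategory.isGE_iff] at hX ⊢
    intro i hi
    rw [hf.isZero_homology_lExtend_iff X i _ rfl]
    exact ⟨Functor.map_isZero _ (hX i (by lia)), h₀ (hX _ (by lia))⟩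
  · rw [DerivedCategory.isLE_iff] at hX ⊢
    intro i hi
    rw [hf.isZero_homology_lExtend_iff X i _ rfl]
    exact ⟨Functor.map_isZero _ (hX i (by lia)), h₀ (hX _ (by lia))⟩

end Left

section Right

variable [ProjDimLE f 1]

lemma hasRCoextend : HasRCoextend f :=
  (hasRightDerivedFunctor_of_resolution (ModuleCat.coextendScalars.{u, u, u} f)
    (rightResNatTrans (toFunctorialInjective (ModuleCat.{u} R))) (fun _ ↦ quasiIso_rightResι _ _)
    (fun X ↦ ∀ n, extVanishing (leftModule f) (X.X n))
    (fun X n ↦ extVanishing_rightRes f X n)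
    (fun _ _ φ hX hY hφ ↦ quasiIso_coextendScalars_map f φ hX hY hφ)).1

variable [HasRCoextend f]

/-- The derived functor `R u^!` is computed by the complexes whose terms have vanishing
`Ext^1_R(U, -)`, and it is right adjoint to `u_*`. For a homological epimorphism, the complexes of
`U`-modules have this property over `R`, so that the unit is an isomorphism. -/
lemma rCoextend_adjunction :
    (∀ X : CochainComplex (ModuleCat.{u} R) ℤ,
      (∀ n, extVanishing (leftModule f) (X.X n)) →
      Nonempty ((rCoextend f).obj (DerivedCategory.Q.obj X) ≅ DerivedCategory.Q.obj
        (((ModuleCat.coextendScalars.{u, u, u} f).mapHomologicalComplex (.up ℤ)).obj X))) ∧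
    ∃ adj : restrictD f ⊣ rCoextend f, IsHomologicalEpi f → IsIso adj.unit := by
  have : (rCoextend f).IsRightDerivedFunctor
      ((coextendK f).totalRightDerivedUnit DerivedCategory.Qh
        (HomotopyCategory.quasiIso _ (.up ℤ)))
      (HomotopyCategory.quasiIso _ (.up ℤ)) := by
    dsimp only [rCoextend]
    infer_instance
  obtain ⟨h, adj, hadj⟩ := rightDerived_adjunction
    (rightResNatTrans (toFunctorialInjective (ModuleCat.{u} R))) (fun _ ↦ quasiIso_rightResι _ _)
    (fun X ↦ ∀ n, extVanishing (leftModule f) (X.X n))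
    (fun X n ↦ extVanishing_rightRes f X n)
    (fun _ _ φ hX hY hφ ↦ quasiIso_coextendScalars_map f φ hX hY hφ)
    (ModuleCat.restrictCoextendScalarsAdj.{u, u, u} f) (rCoextend f)
    ((coextendK f).totalRightDerivedUnit DerivedCategory.Qh
      (HomotopyCategory.quasiIso _ (.up ℤ)))
  exact ⟨h, adj, fun H ↦ hadj H.isIso_unit_app
    fun Y n ↦ H.extVanishing_restrictScalars (Y.X n)⟩

/-- The module `H^{n+1}(R u^! X)` is an extension of `Hom_R(U, H^{n+1}(X))` by `Ext^1_R(U, H^n(X))`,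
so that it vanishes if and only if these two modules vanish. -/
lemma isZero_homology_rCoextend_iff (X : DerivedCategory (ModuleCat.{u} R)) (n m : ℤ)
    (h : n + 1 = m) :
    IsZero ((DerivedCategory.homologyFunctor _ m).obj ((rCoextend f).obj X)) ↔
      extVanishing (leftModule f) ((DerivedCategory.homologyFunctor _ n).obj X) ∧
        IsZero ((ModuleCat.coextendScalars.{u, u, u} f).obj
          ((DerivedCategory.homologyFunctor _ m).obj X)) := by
  let Y := DerivedCategory.Q.objPreimage X
  let K := rightRes (toFunctorialInjective (ModuleCat.{u} R)) Y
  let e : X ≅ DerivedCategory.Q.obj K := (DerivedCategory.Q.objObjPreimageIso X).symm ≪≫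
    asIso (DerivedCategory.Q.map (rightRes.ι (toFunctorialInjective (ModuleCat.{u} R)) Y))
  have hK := extVanishing_rightRes f Y
  obtain ⟨e'⟩ := rCoextend_adjunction.1 K hK
  have e'' (n : ℤ) : (DerivedCategory.homologyFunctor _ n).obj X ≅ K.homology n :=
    (DerivedCategory.homologyFunctor _ n).mapIso e ≪≫
      (DerivedCategory.homologyFunctorFactors _ n).app K
  rw [((DerivedCategory.homologyFunctor _ m).mapIso ((rCoextend f).mapIso e ≪≫ e')).isZero_iff,
    isZero_homologyFunctor_obj_Q_iff, exactAt_coextendScalars_iff f K hK n m h,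
    ((ModuleCat.coextendScalars.{u, u, u} f).mapIso (e'' m)).isZero_iff,
    (extVanishing (leftModule f)).prop_iff_of_iso (e'' n)]

lemma isZero_rCoextend_obj_iff (X : DerivedCategory (ModuleCat.{u} R)) :
    IsZero ((rCoextend f).obj X) ↔
      ∀ n : ℤ, IsContramodule f ((DerivedCategory.homologyFunctor _ n).obj X) := by
  simp only [isZero_iff_isZero_homology, isContramodule_iff]
  constructor
  · intro h n
    exact ⟨((isZero_homology_rCoextend_iff X (n - 1) n (by lia)).1 (h n)).2,
      ((isZero_homology_rCoextend_iff X n (n + 1) rfl).1 (h (n + 1))).1⟩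
  · intro h n
    exact (isZero_homology_rCoextend_iff X (n - 1) n (by lia)).2 ⟨(h _).2, (h _).1⟩

lemma preservesDStar_rCoextend (s : DSymbol) : PreservesDStar (rCoextend f) s := by
  have h₀ {M : ModuleCat.{u} R} (hM : IsZero M) : extVanishing (leftModule f) M := by
    have : Injective M := ⟨fun _ _ _ ↦ ⟨0, hM.eq_of_tgt _ _⟩⟩
    exact .of_injective _
  refine preservesDStar_of_isGE_of_isLE _ 0 1 (fun X n hX ↦ ?_) (fun X n hX ↦ ?_) s
  · rw [DerivedCategory.isGE_iff] at hX ⊢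
    intro i hi
    rw [isZero_homology_rCoextend_iff X (i - 1) i (by lia)]
    exact ⟨h₀ (hX _ (by lia)), Functor.map_isZero _ (hX i (by lia))⟩
  · rw [DerivedCategory.isLE_iff] at hX ⊢
    intro i hi
    rw [isZero_homology_rCoextend_iff X (i - 1) i (by lia)]
    exact ⟨h₀ (hX _ (by lia)), Functor.map_isZero _ (hX i (by lia))⟩

end Right

end Derived

/-! ### Restriction to the derived categories with boundedness conditions -/

section Star

variable {R U : Type u} [Ring R] [Ring U] {f : R →+* U}
  [HasDerivedCategory.{w₁} (ModuleCat.{u} R)] [HasDerivedCategory.{w₂} (ModuleCat.{u} U)]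
  {F : DerivedCategory (ModuleCat.{u} R) ⥤ DerivedCategory (ModuleCat.{u} U)}

/-- The restriction to `D^⋆` of an adjunction `F ⊣ u_*`. -/
def inducedDStarAdjunction (adj : F ⊣ restrictD f) (s : DSymbol) (h : PreservesDStar F s) :
    inducedDStar F s h ⊣ restrictDStar f s :=
  adj.restrictFullyFaithful (s.prop _).fullyFaithfulι (s.prop _).fullyFaithfulι
    (Iso.refl _) (Iso.refl _)

/-- The restriction to `D^⋆` of an adjunction `u_* ⊣ F`. -/
def restrictDStarAdjunction (adj : restrictD f ⊣ F) (s : DSymbol) (h : PreservesDStar F s) :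
    restrictDStar f s ⊣ inducedDStar F s h :=
  adj.restrictFullyFaithful (s.prop _).fullyFaithfulι (s.prop _).fullyFaithfulι
    (Iso.refl _) (Iso.refl _)

end Star

end RingEpi

end

theorem mainTheorem4 {R U : Type u} [Ring R] [Ring U]
    [HasDerivedCategory.{w₁} (ModuleCat.{u} R)] [HasDerivedCategory.{w₂} (ModuleCat.{u} U)]
    (f : R →+* U) (hf : IsHomologicalEpi f) :
    (FlatDimLE f 1 →
      ∃ _ : HasLExtend f, Nonempty (lExtend f ⊣ restrictD f) ∧
        ∀ s : DSymbol,
          (∃ h : PreservesDStar (lExtend f) s,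
            (inducedDStar (lExtend f) s h).kernel = dComodule f s) ∧
          ∃ (_ : (restrictDStar f s).Full) (_ : (restrictDStar f s).Faithful)
            (_ : (dComodule f s).IsTriangulated),
            (toVerdierQuotient f s (dComodule f s)).IsTriangulated ∧
            (toVerdierQuotient f s (dComodule f s)).IsEquivalence) ∧
    (ProjDimLE f 1 →
      ∃ _ : HasRCoextend f, Nonempty (restrictD f ⊣ rCoextend f) ∧
        ∀ s : DSymbol,
          (∃ h : PreservesDStar (rCoextend f) s,
            (inducedDStar (rCoextend f) s h).kernel = dContramodule f s) ∧
          ∃ (_ : (restrictDStar f s).Full) (_ : (restrictDStar f s).Faithful)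
            (_ : (dContramodule f s).IsTriangulated),
            (toVerdierQuotient f s (dContramodule f s)).IsTriangulated ∧
            (toVerdierQuotient f s (dContramodule f s)).IsEquivalence) := by
  refine ⟨fun hU ↦ ?_, fun hU ↦ ?_⟩
  · have := hU.hasLExtend
    obtain ⟨adj, hadj⟩ := hU.lExtend_adjunction.2
    have := hadj hf
    have hff := adj.fullyFaithfulROfIsIsoCounit
    have := hff.full
    have := hff.faithful
    refine ⟨inferInstance, ⟨adj⟩, fun s ↦ ?_⟩
    have h := hU.preservesDStar_lExtend s
    have hker : (inducedDStar (lExtend f) s h).kernel = dComodule f s :=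
      kernel_inducedDStar hU.isZero_lExtend_obj_iff s h
    obtain ⟨_, hequiv⟩ := isEquivalence_of_leftAdjoint (inducedDStarAdjunction adj s h) _ hker
    exact ⟨⟨h, hker⟩, inferInstance, inferInstance, inferInstance, inferInstance, hequiv⟩
  · have := hasRCoextend (f := f)
    obtain ⟨adj, hadj⟩ := rCoextend_adjunction (f := f).2
    have := hadj hf
    have hff := adj.fullyFaithfulLOfIsIsoUnit
    have := hff.full
    have := hff.faithful
    refine ⟨inferInstance, ⟨adj⟩, fun s ↦ ?_⟩
    have h := preservesDStar_rCoextend (f := f) s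
    have hker : (inducedDStar (rCoextend f) s h).kernel = dContramodule f s :=
      kernel_inducedDStar isZero_rCoextend_obj_iff s h
    obtain ⟨_, hequiv⟩ := isEquivalence_of_rightAdjoint (restrictDStarAdjunction adj s h) _ hker
    exact ⟨⟨h, hker⟩, inferInstance, inferInstance, inferInstance, inferInstance, hequiv⟩
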